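/- For a finite simple group $S$ let $\mathrm{rank}(S)$ be its untwisted Lie rank (the rank of the ambient simple algebraic group) if $S$ is of Lie type, $n$ if $S\cong A_n$ is alternating, and $0$ otherwise; for the finitely many groups admitting several such descriptions the smallest of the resulting values is taken. Let $(S_i)_{i\in\mathbb N}$ be a sequence of finite simple groups with $\mathrm{rank}(S_i)\to\infty$ as $i\to\infty$. Then for every real number $\beta\in[0,1]$ there is a sequence of elements $g_i\in S_i$ such that $$\frac{\log |g_i^{S_i}|}{\log |S_i|}\longrightarrow\beta\qquad (i\to\infty),$$ where $g^{S}$ denotes the conjugacy class of $g$ in $S$. Moreover, the $g_i$ can be chosen so that, whenever $S_i\cong A_n$ is an alternating group, some isomorphism $S_i\to A_n$ maps $g_i$ to a single cycle. -/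

import Mathlib

open Filter Topology
open scoped TensorProduct

noncomputable section

namespace FinSimple

/-! ### Groups modulo their centre -/

/-- The quotient of a group by its centre. -/
abbrev ModCenter (G : Type*) [Group G] : Type _ := G ⧸ Subgroup.center G

/-- The derived subgroup of a group, modulo the centre of that derived subgroup. -/
abbrev DerivedModCenter (G : Type*) [Group G] : Type _ := ModCenter (commutator G)

/-! ### Orthogonal groups -/

/-- The full orthogonal group of a quadratic form: the linear automorphisms which preserve it. -/
def orthogonalGroup {K V : Type*} [Field K] [AddCommGroup V] [Module K V]
    (Q : QuadraticForm K V) : Subgroup (V ≃ₗ[K] V) where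
  carrier := {g | ∀ v, Q (g v) = Q v}
  mul_mem' {a b} ha hb v := by
    rw [LinearEquiv.mul_apply, ha, hb]
  one_mem' _ := rfl
  inv_mem' {a} ha v := by
    have h := ha (a⁻¹ v)
    rw [← LinearEquiv.mul_apply, mul_inv_cancel] at h
    exact h.symm

/-- The hyperbolic quadratic form of dimension `2 * n`, i.e. `(f, x) ↦ f x` on `(Kⁿ)* × Kⁿ`. -/
abbrev hyperbolicForm (K : Type) [Field K] (n : ℕ) :
    QuadraticForm K (Module.Dual K (Fin n → K) × (Fin n → K)) :=
  QuadraticForm.dualProd K (Fin n → K)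

/-- The quadratic form in `2 * n + 1` variables: the hyperbolic form plus `z ^ 2`. -/
abbrev oddForm (K : Type) [Field K] (n : ℕ) :
    QuadraticForm K ((Module.Dual K (Fin n → K) × (Fin n → K)) × K) :=
  QuadraticMap.prod (hyperbolicForm K n) QuadraticMap.sq

/-- The binary quadratic form `z ^ 2 + z * w + c * w ^ 2`. -/
def binaryForm (K : Type) [Field K] (c : K) : QuadraticForm K (K × K) :=
  QuadraticMap.linMulLin (LinearMap.fst K K K) (LinearMap.fst K K K) +
    QuadraticMap.linMulLin (LinearMap.fst K K K) (LinearMap.snd K K K) +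
    c • QuadraticMap.linMulLin (LinearMap.snd K K K) (LinearMap.snd K K K)

/-- The quadratic form in `2 * n + 2` variables: the hyperbolic form in `2 * n` variables plus
`z ^ 2 + z * w + c * w ^ 2`; it has minus type when the binary form is anisotropic. -/
abbrev minusForm (K : Type) [Field K] (n : ℕ) (c : K) :
    QuadraticForm K ((Module.Dual K (Fin n → K) × (Fin n → K)) × (K × K)) :=
  QuadraticMap.prod (hyperbolicForm K n) (binaryForm K c)

/-! ### Chevalley groups and their twisted forms

They are needed for the exceptional types only. -/

section Chevalley

variable {n : ℕ} (A : Matrix (Fin n) (Fin n) ℤ)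

/-- The image in the Lie algebra with Cartan matrix `A` over `ℚ` of the Serre generator `E i`
(for `b = true`) or `F i` (for `b = false`). -/
def serreGen (b : Bool) (i : Fin n) : A.ToLieAlgebra ℚ :=
  LieSubmodule.Quotient.mk (N := CartanMatrix.Relations.toIdeal ℚ A)
    (FreeLieAlgebra.of ℚ
      (if b then CartanMatrix.Generators.E i else CartanMatrix.Generators.F i))

/-- The divided power `(ad x) ^ k / k !`, where `x` is a Serre generator. -/
def divPow (b : Bool) (i : Fin n) (k : ℕ) : A.ToLieAlgebra ℚ →ₗ[ℚ] A.ToLieAlgebra ℚ :=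
  ((k.factorial : ℚ)⁻¹) • (LieAlgebra.ad ℚ (A.ToLieAlgebra ℚ) (serreGen A b i) ^ k)

/-- The admissible lattice in the adjoint module: the smallest additive subgroup which contains
the Serre generators `E i`, `F i` and is stable under all the divided powers. -/
def lattice : Submodule ℤ (A.ToLieAlgebra ℚ) :=
  sInf {N | (∀ b i, serreGen A b i ∈ N) ∧ ∀ b i k, ∀ x ∈ N, divPow A b i k x ∈ N}

theorem divPow_mem_lattice (b : Bool) (i : Fin n) (k : ℕ) (x : A.ToLieAlgebra ℚ)
    (hx : x ∈ lattice A) : divPow A b i k x ∈ lattice A := by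
  rw [lattice, Submodule.mem_sInf] at hx ⊢
  exact fun N hN => hN.2 b i k x (hx N hN)

/-- The divided powers acting on the lattice. -/
def latticeDivPow (b : Bool) (i : Fin n) (k : ℕ) : lattice A →ₗ[ℤ] lattice A :=
  ((divPow A b i k).restrictScalars ℤ).restrict (divPow_mem_lattice A b i k)

/-- The root element `x_{±α_i}(t) = ∑ k, t ^ k (ad x) ^ k / k !` on `K ⊗ lattice`. Root strings
have at most four members, so the terms with `4 ≤ k` vanish. -/
def rootElt (K : Type) [Field K] (b : Bool) (i : Fin n) (t : K) :
    Module.End K (K ⊗[ℤ] lattice A) :=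
  ∑ k ∈ Finset.range 4, t ^ k • (latticeDivPow A b i k).baseChange K

/-- The adjoint Chevalley group over `K` with Cartan matrix `A`, generated by the root elements
for the simple roots and their negatives. -/
def chevalley (K : Type) [Field K] : Subgroup (Module.End K (K ⊗[ℤ] lattice A))ˣ :=
  Subgroup.closure
    {u | ∃ b i t, (u : Module.End K (K ⊗[ℤ] lattice A)) = rootElt A K b i t}

/-- The automorphism `σ` of the Chevalley group sends `x_{±α_i}(t)` to `x_{±α_{ρ i}}(t ^ (c i))`. -/
def IsTwist (K : Type) [Field K] (ρ : Equiv.Perm (Fin n)) (c : Fin n → ℕ)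
    (σ : chevalley A K ≃* chevalley A K) : Prop :=
  ∀ (u : chevalley A K) (b : Bool) (i : Fin n) (t : K),
    (u.1 : Module.End K (K ⊗[ℤ] lattice A)) = rootElt A K b i t →
      ((σ u).1 : Module.End K (K ⊗[ℤ] lattice A)) = rootElt A K b (ρ i) (t ^ c i)

/-- The subgroup of elements fixed by an automorphism. -/
def fixedBy {G : Type*} [Group G] (σ : G ≃* G) : Subgroup G :=
  MonoidHom.eqLocus σ.toMonoidHom (MonoidHom.id G)

end Chevalley

/-! ### The rank -/

/-- `HasRank S r`: the group `S` is isomorphic to an alternating group of degree `r`, or to a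
group in one of the families of finite (projective) groups of Lie type, of untwisted Lie rank `r`.
All classical groups are defined by their natural representations. -/
inductive HasRank (S : Type*) [Group S] : ℕ → Prop
  /-- The alternating group of degree `n`. -/
  | alternating (n : ℕ) (e : S ≃* alternatingGroup (Fin n)) : HasRank S n
  /-- `PSL_{n+1}(K)`, type `A_n`. -/
  | linear (K : Type) [Field K] [Finite K] (n : ℕ) (hn : 1 ≤ n)
      (e : S ≃* Matrix.ProjectiveSpecialLinearGroup (Fin (n + 1)) K) : HasRank S n
  /-- `PSU_{n+1}` over a finite field with a nontrivial involution, type `²A_n`. -/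
  | unitary (K : Type) [Field K] [Finite K] [StarRing K] (hstar : ∃ x : K, star x ≠ x)
      (n : ℕ) (hn : 2 ≤ n)
      (e : S ≃* ModCenter (Matrix.specialUnitaryGroup (Fin (n + 1)) K)) : HasRank S n
  /-- `PSp_{2n}(K)`, type `C_n`. -/
  | symplectic (K : Type) [Field K] [Finite K] (n : ℕ) (hn : 2 ≤ n)
      (e : S ≃* ModCenter (Matrix.symplecticGroup (Fin n) K)) : HasRank S n
  /-- `PΩ_{2n+1}(K)` in odd characteristic, type `B_n`. -/
  | orthogonalOdd (K : Type) [Field K] [Finite K] (h2 : (2 : K) ≠ 0) (n : ℕ) (hn : 3 ≤ n)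
      (e : S ≃* DerivedModCenter (orthogonalGroup (oddForm K n))) : HasRank S n
  /-- `PΩ⁺_{2n}(K)`, type `D_n`. -/
  | orthogonalPlus (K : Type) [Field K] [Finite K] (n : ℕ) (hn : 4 ≤ n)
      (e : S ≃* DerivedModCenter (orthogonalGroup (hyperbolicForm K n))) : HasRank S n
  /-- `PΩ⁻_{2n+2}(K)`, type `²D_{n+1}`. -/
  | orthogonalMinus (K : Type) [Field K] [Finite K] (c : K)
      (hc : (binaryForm K c).Anisotropic) (n : ℕ) (hn : 4 ≤ n + 1)
      (e : S ≃* DerivedModCenter (orthogonalGroup (minusForm K n c))) : HasRank S (n + 1)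
  /-- `G₂(K)`, or its derived subgroup when `|K| = 2`. -/
  | typeG₂ (K : Type) [Field K] [Finite K]
      (e : S ≃* DerivedModCenter (chevalley CartanMatrix.G₂ K)) : HasRank S 2
  /-- `F₄(K)`. -/
  | typeF₄ (K : Type) [Field K] [Finite K]
      (e : S ≃* DerivedModCenter (chevalley CartanMatrix.F₄ K)) : HasRank S 4
  /-- `E₆(K)`. -/
  | typeE₆ (K : Type) [Field K] [Finite K]
      (e : S ≃* DerivedModCenter (chevalley CartanMatrix.E₆ K)) : HasRank S 6
  /-- `E₇(K)`. -/
  | typeE₇ (K : Type) [Field K] [Finite K]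
      (e : S ≃* DerivedModCenter (chevalley CartanMatrix.E₇ K)) : HasRank S 7
  /-- `E₈(K)`. -/
  | typeE₈ (K : Type) [Field K] [Finite K]
      (e : S ≃* DerivedModCenter (chevalley CartanMatrix.E₈ K)) : HasRank S 8
  /-- `³D₄(q)`, with `|K| = q ^ 3`. -/
  | twistedD₄ (K : Type) [Field K] [Finite K] (q : ℕ) (hq : Nat.card K = q ^ 3)
      (σ : chevalley (CartanMatrix.D 4) K ≃* chevalley (CartanMatrix.D 4) K)
      (hσ : IsTwist (CartanMatrix.D 4) K (Equiv.swap 0 2 * Equiv.swap 2 3) (fun _ => q) σ)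
      (e : S ≃* DerivedModCenter (fixedBy σ)) : HasRank S 4
  /-- `²E₆(q)`, with `|K| = q ^ 2`. -/
  | twistedE₆ (K : Type) [Field K] [Finite K] (q : ℕ) (hq : Nat.card K = q ^ 2)
      (σ : chevalley CartanMatrix.E₆ K ≃* chevalley CartanMatrix.E₆ K)
      (hσ : IsTwist CartanMatrix.E₆ K (Equiv.swap 0 5 * Equiv.swap 2 4) (fun _ => q) σ)
      (e : S ≃* DerivedModCenter (fixedBy σ)) : HasRank S 6
  /-- The Suzuki group `²B₂(2 ^ (2 * m + 1))`; here `α_0` is short and `α_1` is long. -/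
  | suzuki (K : Type) [Field K] [Finite K] (m : ℕ) (hm : 1 ≤ m)
      (hK : Nat.card K = 2 ^ (2 * m + 1))
      (σ : chevalley (CartanMatrix.B 2) K ≃* chevalley (CartanMatrix.B 2) K)
      (hσ : IsTwist (CartanMatrix.B 2) K (Equiv.swap 0 1) ![2 ^ (m + 1), 2 ^ m] σ)
      (e : S ≃* DerivedModCenter (fixedBy σ)) : HasRank S 2
  /-- The Ree group `²G₂(3 ^ (2 * m + 1))`; here `α_0` is short and `α_1` is long. -/
  | reeG₂ (K : Type) [Field K] [Finite K] (m : ℕ) (hm : 1 ≤ m)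
      (hK : Nat.card K = 3 ^ (2 * m + 1))
      (σ : chevalley CartanMatrix.G₂ K ≃* chevalley CartanMatrix.G₂ K)
      (hσ : IsTwist CartanMatrix.G₂ K (Equiv.swap 0 1) ![3 ^ (m + 1), 3 ^ m] σ)
      (e : S ≃* DerivedModCenter (fixedBy σ)) : HasRank S 2
  /-- The Ree group `²F₄(2 ^ (2 * m + 1))`, or its derived subgroup, the Tits group, when `m = 0`;
  here `α_0`, `α_1` are short and `α_2`, `α_3` are long. -/
  | reeF₄ (K : Type) [Field K] [Finite K] (m : ℕ) (hK : Nat.card K = 2 ^ (2 * m + 1))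
      (σ : chevalley CartanMatrix.F₄ K ≃* chevalley CartanMatrix.F₄ K)
      (hσ : IsTwist CartanMatrix.F₄ K (Equiv.swap 0 3 * Equiv.swap 1 2)
        ![2 ^ (m + 1), 2 ^ (m + 1), 2 ^ m, 2 ^ m] σ)
      (e : S ≃* DerivedModCenter (fixedBy σ)) : HasRank S 4

/-- The rank of a finite simple group: the untwisted Lie rank for a group of Lie type, `n` for the
alternating group of degree `n`, and `0` for all other groups (`sInf ∅ = 0` in `ℕ`). The few groups
with several descriptions are given the smallest of the ranks; for the groups which are both
alternating and of Lie type that is a Lie rank. -/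
def rank (S : Type*) [Group S] : ℕ := sInf {r | HasRank S r}

end FinSimple

end

/-!
Write `log |g ^ G| / log |G|` for the logarithmic size of the conjugacy class of `g`. The class of a
product lies in the product of the classes, so logarithmic class sizes are subadditive. Hence, if
`S` is simple, `h ≠ 1` has a class of size at most `|S| ^ (1 / t)`, and `g` has a centralizer of
order at most `|S| ^ (1 / t)`, one writes `g` as a product of conjugates of `h`: along the
partial products the logarithmic class size starts at `0`, grows by at most `1 / t` at each step and ends above
`1 - 1 / t`, so some partial product comes within `1 / t` of any given `β ∈ [0, 1]`
(`exists_abs_logRatio_sub_le`). It remains to find `g` and `h` for every `t` once the rank is large.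

For `A_n` the sequence consists of the cycles `(0 1 … 2k)` themselves, consecutive ones
differing by a product of two transpositions. This applies whenever `S ≅ A_n`, since then
`rank S ≤ n`.

Otherwise a large rank forces `S` to be classical: `S ≅ H / Z(H)`, where `H` lies between the full
isometry group `G` of the form (or the general linear group) and its derived subgroup. In each case
`G` contains a symmetric group of degree close to the rank, permuting a spanning set of the natural
module `V` with at most four orbits (`PermutesSpanning`). Then
* `g` is the square of a long cycle; it is a commutator, and an element commuting with it is
  determined by its values at boundedly many vectors, so its centralizer has order at most
  `|V| ^ O(1)`;
* `h` is a commutator of transpositions; as a transposition differs from the identity by an operator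
  of bounded rank, its class has size at most `|V| ^ O(1)`;
* the index of the derived subgroup is at most the order of any centralizer, hence also
  `|V| ^ O(1)`.
Finally `|G|` is at least `|K|` to a power quadratic in the rank, because of explicit
unipotent elements parametrized by strictly triangular matrices, whereas `|V|` is `|K|` to a power
linear in the rank. No exact group orders are needed.
-/

noncomputable section

namespace FinSimple

/-! ### Class sizes and centralizers in finite groups -/

theorem ncard_conjugatesOf_mul_card_centralizer {G : Type*} [Group G] [Finite G] (g : G) :
    (conjugatesOf g).ncard * Nat.card (Subgroup.centralizer {g}) = Nat.card G := by
  rw [Subgroup.nat_card_centralizer_nat_card_stabilizer]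
  have h : conjugatesOf g = MulAction.orbit (ConjAct G) g := by
    rw [ConjAct.orbit_eq_carrier_conjClasses]; rfl
  rw [h, ← MulAction.index_stabilizer, Subgroup.index_mul_card]
  rfl

theorem ncard_conjugatesOf_pos {G : Type*} [Group G] [Finite G] (g : G) :
    0 < (conjugatesOf g).ncard :=
  (Set.ncard_pos (Set.toFinite _)).2 ⟨g, mem_conjugatesOf_self⟩

theorem ncard_conjugatesOf_one {G : Type*} [Group G] : (conjugatesOf (1 : G)).ncard = 1 := by
  have : conjugatesOf (1 : G) = {1} := by
    ext x
    simp [conjugatesOf, isConj_iff, eq_comm]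
  rw [this, Set.ncard_singleton]

open Pointwise in
/-- The class of a product lies in the product of the classes, so class sizes are
submultiplicative. -/
theorem ncard_conjugatesOf_mul_le {G : Type*} [Group G] [Finite G] (a b : G) :
    (conjugatesOf (a * b)).ncard ≤ (conjugatesOf a).ncard * (conjugatesOf b).ncard := by
  have h : conjugatesOf (a * b) ⊆ conjugatesOf a * conjugatesOf b := by
    intro x hx
    obtain ⟨c, rfl⟩ := isConj_iff.1 (show IsConj (a * b) x from hx)
    exact ⟨c * a * c⁻¹, isConj_iff.2 ⟨c, rfl⟩, c * b * c⁻¹, isConj_iff.2 ⟨c, rfl⟩, by group⟩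
  calc _ ≤ (conjugatesOf a * conjugatesOf b).ncard := Set.ncard_le_ncard h (Set.toFinite _)
    _ ≤ _ := Set.natCard_mul_le

theorem ncard_conjugatesOf_inv {G : Type*} [Group G] (a : G) :
    (conjugatesOf a⁻¹).ncard = (conjugatesOf a).ncard := by
  have h : conjugatesOf a⁻¹ = (fun x => x⁻¹) '' conjugatesOf a := by
    ext x
    simp only [conjugatesOf, isConj_iff, Set.mem_ofPred_eq, Set.mem_image]
    constructor
    · rintro ⟨c, rfl⟩
      exact ⟨c * a * c⁻¹, ⟨c, rfl⟩, by group⟩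
    · rintro ⟨_, ⟨c, rfl⟩, rfl⟩
      exact ⟨c, by group⟩
  rw [h, Set.ncard_image_of_injective _ inv_injective]

open scoped commutatorElement in
theorem ncard_conjugatesOf_commutatorElement_le {G : Type*} [Group G] [Finite G] (a b : G) :
    (conjugatesOf ⁅a, b⁆).ncard ≤ (conjugatesOf a).ncard ^ 2 := by
  have h : IsConj a⁻¹ (b * a⁻¹ * b⁻¹) := isConj_iff.2 ⟨b, rfl⟩
  have := ncard_conjugatesOf_mul_le a (b * a⁻¹ * b⁻¹)
  rwa [← h.conjugatesOf_eq, ncard_conjugatesOf_inv, ← sq, ← mul_assoc, ← mul_assoc,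
    ← commutatorElement_def] at this

theorem ncard_conjugatesOf_le_map {H G : Type*} [Group H] [Group G] [Finite G] (f : H →* G)
    (hf : Function.Injective f) (h : H) :
    (conjugatesOf h).ncard ≤ (conjugatesOf (f h)).ncard := by
  rw [← Set.ncard_image_of_injective _ hf]
  refine Set.ncard_le_ncard ?_ (Set.toFinite _)
  rintro _ ⟨x, hx, rfl⟩
  exact f.map_isConj hx

theorem card_centralizer_le_map {H G : Type*} [Group H] [Group G] [Finite G] (f : H →* G)
    (hf : Function.Injective f) (h : H) :
    Nat.card (Subgroup.centralizer {h}) ≤ Nat.card (Subgroup.centralizer {f h}) := by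
  refine Nat.card_le_card_of_injective (fun x => ⟨f x.1, ?_⟩) ?_
  · have := x.2
    rw [Subgroup.mem_centralizer_singleton_iff] at this ⊢
    rw [← map_mul, ← map_mul, this]
  · intro x y hxy
    exact Subtype.ext (hf (congrArg Subtype.val hxy))

theorem ncard_conjugatesOf_map_le {H G : Type*} [Group H] [Group G] [Finite H] (f : H →* G)
    (hf : Function.Surjective f) (h : H) :
    (conjugatesOf (f h)).ncard ≤ (conjugatesOf h).ncard := by
  refine (Set.ncard_le_ncard ?_ ((Set.toFinite _).image f)).trans
    (Set.ncard_image_le (Set.toFinite (conjugatesOf h)))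
  intro x hx
  obtain ⟨c, rfl⟩ := isConj_iff.1 (show IsConj (f h) x from hx)
  obtain ⟨d, rfl⟩ := hf c
  exact ⟨d * h * d⁻¹, isConj_iff.2 ⟨d, rfl⟩, by simp⟩

/-- Passing to a central quotient divides the group order by `|Z|` and a class size by at most
`|Z|`. -/
theorem card_centralizer_mk_le {H : Type*} [Group H] [Finite H] (g : H) :
    Nat.card (Subgroup.centralizer {(g : ModCenter H)}) ≤
      Nat.card (Subgroup.centralizer {g}) := by
  have hcl : (conjugatesOf g).ncard ≤
      (conjugatesOf (g : ModCenter H)).ncard * Nat.card (Subgroup.center H) := by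
    rw [← Nat.card_coe_set_eq, ← Nat.card_coe_set_eq, ← Nat.card_prod]
    refine Nat.card_le_card_of_injective
      (fun x => (⟨(x.1 : ModCenter H), (QuotientGroup.mk' _).map_isConj x.2⟩,
        ⟨(Quotient.out (x.1 : ModCenter H))⁻¹ * x.1, ?_⟩)) ?_
    · exact QuotientGroup.eq.1 (Quotient.out_eq' _)
    · intro x y hxy
      simp only [Prod.mk.injEq, Subtype.mk.injEq] at hxy
      have h1 : (x.1 : ModCenter H) = y.1 := congrArg Subtype.val hxy.1
      have h2 := hxy.2
      rw [h1] at h2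
      exact Subtype.ext (mul_left_cancel h2)
  have h1 := ncard_conjugatesOf_mul_card_centralizer g
  have h2 := ncard_conjugatesOf_mul_card_centralizer (g : ModCenter H)
  have h3 := Subgroup.card_eq_card_quotient_mul_card_subgroup (Subgroup.center H)
  rw [← h2, ← h1] at h3
  refine Nat.le_of_mul_le_mul_left ?_ (ncard_conjugatesOf_pos g)
  rw [h3]
  calc _ ≤ (conjugatesOf (g : ModCenter H)).ncard * Nat.card (Subgroup.center H) *
        Nat.card (Subgroup.centralizer {(g : ModCenter H)}) := Nat.mul_le_mul_right _ hcl
    _ = _ := by ring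

/-- The commutators `⁅y, s⁆` with `s` fixed are as many as the conjugates of `s`. -/
theorem card_le_card_centralizer_mul_card_commutator {G : Type*} [Group G] [Finite G] (s : G) :
    Nat.card G ≤ Nat.card (Subgroup.centralizer {s}) * Nat.card (commutator G) := by
  rw [← ncard_conjugatesOf_mul_card_centralizer s, mul_comm]
  refine Nat.mul_le_mul_left _ ?_
  rw [← Nat.card_coe_set_eq]
  refine Nat.card_le_card_of_injective (fun x => ⟨x.1 * s⁻¹, ?_⟩) ?_
  · obtain ⟨c, hc⟩ := isConj_iff.1 (show IsConj s x.1 from x.2)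
    rw [← hc]
    exact Subgroup.commutator_mem_commutator (Subgroup.mem_top c) (Subgroup.mem_top s)
  · intro x y hxy
    exact Subtype.ext (mul_right_cancel (congrArg Subtype.val hxy))

/-- In a finite simple group every element is a product of conjugates of a given nontrivial
element. -/
theorem exists_list_conjugates_prod_eq {S : Type*} [Group S] [Finite S] [IsSimpleGroup S] {h : S}
    (hh : h ≠ 1) (g : S) : ∃ l : List S, (∀ y ∈ l, IsConj h y) ∧ l.prod = g := by
  have htop : Subgroup.normalClosure ({h} : Set S) = ⊤ := by
    refine (Subgroup.normalClosure_normal.eq_bot_or_eq_top).resolve_left fun hb => hh ?_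
    rw [← Subgroup.mem_bot, ← hb]
    exact Subgroup.subset_normalClosure rfl
  have hg : g ∈ Submonoid.closure (Group.conjugatesOfSet ({h} : Set S)) := by
    rw [← Subgroup.closure_toSubmonoid_of_finite, Subgroup.mem_toSubmonoid]
    change g ∈ Subgroup.normalClosure ({h} : Set S)
    rw [htop]
    trivial
  obtain ⟨l, hl, hp⟩ := Submonoid.exists_list_of_mem_closure hg
  refine ⟨l, fun y hy => ?_, hp⟩
  simpa [Group.mem_conjugatesOfSet_iff] using hl y hy

/-! ### The discrete intermediate value argument -/

/-- The logarithmic size `log |g ^ G| / log |G|` of the conjugacy class of `g`. -/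
def logRatio {G : Type*} [Group G] (g : G) : ℝ :=
  Real.log ((conjugatesOf g).ncard : ℝ) / Real.log (Nat.card G : ℝ)

/-- If the class sizes along `x 0, …, x N` start at `M` or less, grow by a factor of at most `M`
at each step, and end within a factor `M` of `|G|`, where `M ^ t ≤ |G|`, then the logarithmic
class sizes form a `1 / t`-net of the unit interval. -/
theorem exists_abs_logRatio_sub_le {G : Type*} [Group G] [Finite G] [Nontrivial G] {x : ℕ → G}
    {N t M : ℕ} (ht : 0 < t) (hM : M ^ t ≤ Nat.card G) (h0 : (conjugatesOf (x 0)).ncard ≤ M)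
    (hstep : ∀ k < N, (conjugatesOf (x (k + 1))).ncard ≤ (conjugatesOf (x k)).ncard * M)
    (hN : Nat.card (Subgroup.centralizer {x N}) ≤ M) {β : ℝ} (hβ : β ∈ Set.Icc (0 : ℝ) 1) :
    ∃ k ≤ N, |logRatio (x k) - β| ≤ 1 / t := by
  have hcpos : ∀ g : G, (0 : ℝ) < (conjugatesOf g).ncard := fun g =>
    Nat.cast_pos.2 (ncard_conjugatesOf_pos g)
  have hMpos : (0 : ℝ) < M := Nat.cast_pos.2 ((ncard_conjugatesOf_pos (x 0)).trans_le h0)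
  have hL : 0 < Real.log (Nat.card G : ℝ) := Real.log_pos (by exact_mod_cast Finite.one_lt_card)
  have htpos : (0 : ℝ) < t := Nat.cast_pos.2 ht
  have hlogM : Real.log M / Real.log (Nat.card G : ℝ) ≤ 1 / t := by
    rw [div_le_div_iff₀ hL htpos, mul_comm, one_mul, ← Real.log_pow]
    exact Real.log_le_log (by positivity) (by exact_mod_cast hM)
  have r0 : logRatio (x 0) ≤ 1 / t := le_trans
    (div_le_div_of_nonneg_right (Real.log_le_log (hcpos _) (by exact_mod_cast h0)) hL.le) hlogM
  have rstep : ∀ k < N, logRatio (x (k + 1)) ≤ logRatio (x k) + 1 / t := by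
    intro k hk
    have h1 : Real.log ((conjugatesOf (x (k + 1))).ncard : ℝ) ≤
        Real.log ((conjugatesOf (x k)).ncard : ℝ) + Real.log M := by
      rw [← Real.log_mul (hcpos _).ne' hMpos.ne']
      exact Real.log_le_log (hcpos _) (by exact_mod_cast hstep k hk)
    calc _ ≤ (Real.log ((conjugatesOf (x k)).ncard : ℝ) + Real.log M) /
          Real.log (Nat.card G : ℝ) := div_le_div_of_nonneg_right h1 hL.le
      _ ≤ _ := by rw [add_div]; exact add_le_add_right hlogM _
  have rN : 1 - 1 / t ≤ logRatio (x N) := by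
    have h1 : Real.log (Nat.card G : ℝ) ≤
        Real.log ((conjugatesOf (x N)).ncard : ℝ) + Real.log M := by
      rw [← Real.log_mul (hcpos _).ne' hMpos.ne', ← ncard_conjugatesOf_mul_card_centralizer (x N)]
      refine Real.log_le_log ?_ ?_
      · rw [ncard_conjugatesOf_mul_card_centralizer]
        exact_mod_cast Nat.card_pos
      · exact_mod_cast Nat.mul_le_mul_left _ hN
    have h2 := div_le_div_of_nonneg_right h1 hL.le
    rw [div_self hL.ne', add_div] at h2
    have h3 : logRatio (x N) = Real.log ((conjugatesOf (x N)).ncard : ℝ) /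
      Real.log (Nat.card G : ℝ) := rfl
    linarith
  have hε : (0 : ℝ) < 1 / t := by positivity
  by_cases hb : logRatio (x N) ≤ β
  · exact ⟨N, le_rfl, abs_le.2 ⟨by linarith [hβ.2], by linarith⟩⟩
  · classical
    have hex : ∃ k, β < logRatio (x k) := ⟨N, not_le.1 hb⟩
    have hk := Nat.find_spec hex
    have hkN : Nat.find hex ≤ N := Nat.find_min' hex (not_le.1 hb)
    rcases hkk : Nat.find hex with _ | k
    · rw [hkk] at hk
      exact ⟨0, Nat.zero_le _, abs_le.2 ⟨by linarith, by linarith [hβ.1]⟩⟩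
    · have hmin : logRatio (x k) ≤ β := not_lt.1 (Nat.find_min hex (by omega))
      have := rstep k (by omega)
      rw [hkk] at hk
      exact ⟨k + 1, by omega, abs_le.2 ⟨by linarith, by linarith⟩⟩

/-- `HasSpread G t` says that `G` has an element whose centralizer has order at most
`|G| ^ (1 / t)`, and a nontrivial element whose conjugacy class has size at most
`|G| ^ (1 / t)`. -/
def HasSpread (G : Type*) [Group G] (t : ℕ) : Prop :=
  ∃ (M : ℕ) (g h : G), h ≠ 1 ∧ Nat.card (Subgroup.centralizer {g}) ≤ M ∧
    (conjugatesOf h).ncard ≤ M ∧ M ^ t ≤ Nat.card G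

theorem HasSpread.exists_abs_logRatio_sub_le {S : Type*} [Group S] [Finite S] [IsSimpleGroup S]
    {t : ℕ} (hS : HasSpread S t) (ht : 0 < t) {β : ℝ} (hβ : β ∈ Set.Icc (0 : ℝ) 1) :
    ∃ g : S, |logRatio g - β| ≤ 1 / t := by
  obtain ⟨M, g, h, hh, hg, hc, hM⟩ := hS
  obtain ⟨l, hl, hp⟩ := exists_list_conjugates_prod_eq hh g
  have hMpos : 0 < M := (ncard_conjugatesOf_pos h).trans_le hc
  obtain ⟨k, -, hk⟩ := FinSimple.exists_abs_logRatio_sub_le (x := fun k => (l.take k).prod)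
    (N := l.length) ht hM (by simpa [ncard_conjugatesOf_one] using Nat.succ_le_of_lt hMpos)
    (fun k hk => by
      rw [List.take_succ_eq_append_getElem hk, List.prod_append, List.prod_singleton]
      refine (ncard_conjugatesOf_mul_le _ _).trans (Nat.mul_le_mul_left _ ?_)
      rwa [← (hl _ (List.getElem_mem hk)).conjugatesOf_eq])
    (by simpa [hp] using hg) hβ
  exact ⟨_, hk⟩

theorem HasSpread.of_mulEquiv {S G : Type*} [Group S] [Group G] [Finite S] [Finite G] {t : ℕ}
    (hG : HasSpread G t) (e : S ≃* G) : HasSpread S t := by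
  obtain ⟨M, g, h, hh, hg, hc, hM⟩ := hG
  refine ⟨M, e.symm g, e.symm h, by simpa using hh, ?_, ?_, ?_⟩
  · simpa using (card_centralizer_le_map e.toMonoidHom e.injective (e.symm g)).trans (by simpa)
  · simpa using (ncard_conjugatesOf_le_map e.toMonoidHom e.injective (e.symm h)).trans (by simpa)
  · rwa [Nat.card_congr e.toEquiv]

/-- Transfer from a group `G` to `H / Z(H)`, where `H` lies between `G` and its derived
subgroup. -/
theorem hasSpread_modCenter {G H : Type*} [Group G] [Finite G] [Group H] (f : H →* G)
    (hf : Function.Injective f) (hG : commutator G ≤ f.range) {t M : ℕ} {g h : H}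
    (hgM : Nat.card (Subgroup.centralizer {f g}) ≤ M) (hhM : (conjugatesOf (f h)).ncard ≤ M)
    (hh : h ∉ Subgroup.center H) (hM : M ^ (t + 2) ≤ Nat.card G) :
    HasSpread (ModCenter H) t := by
  have : Finite H := Finite.of_injective f hf
  have hMpos : 0 < M := (ncard_conjugatesOf_pos _).trans_le hhM
  have hgH : Nat.card (Subgroup.centralizer {g}) ≤ M := (card_centralizer_le_map f hf g).trans hgM
  refine ⟨M, (g : ModCenter H), (h : ModCenter H), ?_, ?_, ?_, ?_⟩
  · rwa [Ne, QuotientGroup.eq_one_iff]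
  · exact (card_centralizer_mk_le g).trans hgH
  · exact (ncard_conjugatesOf_map_le (QuotientGroup.mk' (Subgroup.center H))
      (QuotientGroup.mk'_surjective _) h).trans ((ncard_conjugatesOf_le_map f hf h).trans hhM)
  · have h1 : Nat.card G ≤ M * Nat.card H := by
      refine (card_le_card_centralizer_mul_card_commutator (f g)).trans
        (Nat.mul_le_mul hgM ?_)
      refine (Subgroup.card_le_of_le hG).trans_eq ?_
      exact (Nat.card_congr (MonoidHom.ofInjective hf).toEquiv).symm
    have h2 : Nat.card H ≤ Nat.card (ModCenter H) * M := by
      rw [Subgroup.card_eq_card_quotient_mul_card_subgroup (Subgroup.center H)]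
      exact Nat.mul_le_mul_left _
        ((Subgroup.card_le_of_le (Subgroup.center_le_centralizer _)).trans hgH)
    have h3 : M ^ 2 * M ^ t ≤ M ^ 2 * Nat.card (ModCenter H) := by
      rw [← pow_add, add_comm]
      refine hM.trans (h1.trans ((Nat.mul_le_mul_left _ h2).trans_eq (by ring)))
    exact Nat.le_of_mul_le_mul_left h3 (pow_pos hMpos 2)

/-! ### Cycles in alternating groups -/

theorem ncard_conjugatesOf_swap_le {α : Type*} [DecidableEq α] [Finite α] (a b : α) :
    (conjugatesOf (Equiv.swap a b)).ncard ≤ Nat.card α ^ 2 := by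
  have h : conjugatesOf (Equiv.swap a b) ⊆ Set.range fun p : α × α => Equiv.swap p.1 p.2 := by
    intro x hx
    obtain ⟨c, rfl⟩ := isConj_iff.1 (show IsConj (Equiv.swap a b) x from hx)
    exact ⟨(c a, c b), Equiv.swap_apply_apply c a b⟩
  refine (Set.ncard_le_ncard h (Set.toFinite _)).trans ?_
  rw [← Set.image_univ, sq, ← Nat.card_prod]
  exact (Set.ncard_image_le (Set.toFinite _)).trans_eq (Set.ncard_univ _)

theorem cycleRange_succ_eq_mul_swap {m i : ℕ} (hi : i + 1 < m + 1) :
    Fin.cycleRange (⟨i + 1, hi⟩ : Fin (m + 1)) = Fin.cycleRange ⟨i, by omega⟩ *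
      Equiv.swap ⟨i, by omega⟩ ⟨i + 1, hi⟩ := by
  have hval : ∀ j : Fin (m + 1), j.1 < m → (j + 1).1 = j.1 + 1 := fun j hj => by
    rw [Fin.val_add_one_of_lt (Fin.lt_def.2 hj)]
  ext j
  rw [Equiv.Perm.mul_apply, Equiv.swap_apply_def]
  rcases lt_trichotomy j.1 i with h | h | h
  · rw [if_neg (by simp [Fin.ext_iff]; omega), if_neg (by simp [Fin.ext_iff]; omega),
      Fin.cycleRange_of_lt (Fin.lt_def.2 (by simp; omega)), Fin.cycleRange_of_lt (Fin.lt_def.2 h)]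
  · rw [if_pos (Fin.ext h), Fin.cycleRange_of_lt (Fin.lt_def.2 (by simp; omega)),
      Fin.cycleRange_of_gt (Fin.lt_def.2 (by simp)), hval j (by omega), h]
  · rcases Nat.lt_or_ge (i + 1) j.1 with h' | h'
    · rw [if_neg (by simp [Fin.ext_iff]; omega), if_neg (by simp [Fin.ext_iff]; omega),
        Fin.cycleRange_of_gt (Fin.lt_def.2 h'), Fin.cycleRange_of_gt (Fin.lt_def.2 h)]
    · have hj : j = ⟨i + 1, hi⟩ := Fin.ext (by simp; omega)
      rw [if_neg (by simp [Fin.ext_iff]; omega), if_pos hj, hj, Fin.cycleRange_self,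
        Fin.cycleRange_self]

/-- A permutation commuting with a cycle which moves all points but possibly one is determined by
two of its values. -/
theorem card_centralizer_cycleRange_le {m i : ℕ} (hi : i < m + 1) (him : m ≤ i + 1) :
    Nat.card (Subgroup.centralizer {Fin.cycleRange (⟨i, hi⟩ : Fin (m + 1))}) ≤ (m + 1) ^ 2 := by
  have hcard : Nat.card (Fin (m + 1) × Fin (m + 1)) = (m + 1) ^ 2 := by simp [sq]
  rw [← hcard]
  refine Nat.card_le_card_of_injective (fun x => (x.1 0, x.1 (Fin.last m))) ?_
  intro x y hxy
  simp only [Prod.mk.injEq] at hxy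
  have hx := Subgroup.mem_centralizer_singleton_iff.1 x.2
  have hy := Subgroup.mem_centralizer_singleton_iff.1 y.2
  have key : ∀ (k : ℕ) (hk : k < m + 1), k ≤ i → x.1 ⟨k, hk⟩ = y.1 ⟨k, hk⟩ := by
    intro k
    induction k with
    | zero => intro _ _; exact hxy.1
    | succ k ih =>
      intro hk hki
      have hc : Fin.cycleRange (⟨i, hi⟩ : Fin (m + 1)) ⟨k, by omega⟩ = ⟨k + 1, hk⟩ := by
        rw [Fin.cycleRange_of_lt (Fin.lt_def.2 (by simp; omega))]
        exact Fin.ext (Fin.val_add_one_of_lt (Fin.lt_def.2 (by simp; omega)))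
      have hx' := Equiv.congr_fun hx ⟨k, by omega⟩
      have hy' := Equiv.congr_fun hy ⟨k, by omega⟩
      rw [Equiv.Perm.mul_apply, Equiv.Perm.mul_apply, hc] at hx' hy'
      rw [hx', hy', ih (by omega) (by omega)]
  refine Subtype.ext (Equiv.ext fun j => ?_)
  by_cases hj : j.1 ≤ i
  · exact key j.1 j.2 hj
  · have : j = Fin.last m := Fin.ext (by simp; omega)
    rw [this]
    exact hxy.2

/-- The intermediate value argument along the cycles `(0 1 … 2k)`, whose successive quotients are
products of two transpositions. -/
theorem exists_isCycle_abs_logRatio_sub_le {m t : ℕ} (hm : 2 ≤ m) (ht : 0 < t)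
    (hM : ((m + 1) ^ 4) ^ t ≤ Nat.card (alternatingGroup (Fin (m + 1)))) {β : ℝ}
    (hβ : β ∈ Set.Icc (0 : ℝ) 1) :
    ∃ g : alternatingGroup (Fin (m + 1)), (g : Equiv.Perm (Fin (m + 1))).IsCycle ∧
      |logRatio g - β| ≤ 1 / t := by
  have : Nontrivial (alternatingGroup (Fin (m + 1))) :=
    alternatingGroup.nontrivial_of_three_le_card (by simp; omega)
  let c : ∀ i : ℕ, 2 * i < m + 1 → alternatingGroup (Fin (m + 1)) := fun i hi =>
    ⟨Fin.cycleRange ⟨2 * i, hi⟩, by simp [Equiv.Perm.mem_alternatingGroup, Fin.sign_cycleRange]⟩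
  have hstep : ∀ i (hi : 2 * (i + 1) < m + 1), (conjugatesOf (c (i + 1) hi)).ncard ≤
      (conjugatesOf (c i (by omega))).ncard * (m + 1) ^ 4 := by
    intro i hi
    have hd : ((c i (by omega))⁻¹ * c (i + 1) hi : alternatingGroup (Fin (m + 1))).1 =
        Equiv.swap ⟨2 * i, by omega⟩ ⟨2 * i + 1, by omega⟩ *
          Equiv.swap ⟨2 * i + 1, by omega⟩ ⟨2 * i + 1 + 1, hi⟩ := by
      have h1 : (c (i + 1) hi).1 = Fin.cycleRange (⟨2 * i, by omega⟩ : Fin (m + 1)) *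
          Equiv.swap ⟨2 * i, by omega⟩ ⟨2 * i + 1, by omega⟩ *
          Equiv.swap ⟨2 * i + 1, by omega⟩ ⟨2 * i + 1 + 1, hi⟩ := by
        rw [← cycleRange_succ_eq_mul_swap, ← cycleRange_succ_eq_mul_swap]
        rfl
      rw [Subgroup.coe_mul, h1, Subgroup.coe_inv]
      simp [c, mul_assoc]
    have h2 := ncard_conjugatesOf_mul_le (c i (by omega)) ((c i (by omega))⁻¹ * c (i + 1) hi)
    rw [mul_inv_cancel_left] at h2
    refine h2.trans (Nat.mul_le_mul_left _ ?_)
    refine (ncard_conjugatesOf_le_map (alternatingGroup (Fin (m + 1))).subtype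
      (Subgroup.subtype_injective _) _).trans ?_
    rw [Subgroup.subtype_apply, hd]
    refine (ncard_conjugatesOf_mul_le _ _).trans ((Nat.mul_le_mul (ncard_conjugatesOf_swap_le _ _)
      (ncard_conjugatesOf_swap_le _ _)).trans_eq ?_)
    rw [Nat.card_fin]
    ring
  have hc0 : c 0 (by omega) = 1 := Subtype.ext (Fin.cycleRange_zero (m + 1))
  let x : ℕ → alternatingGroup (Fin (m + 1)) := fun k =>
    if h : 2 * (k + 1) < m + 1 then c (k + 1) h else 1
  have hx : ∀ k ≤ m / 2 - 1, ∃ h : 2 * (k + 1) < m + 1, x k = c (k + 1) h := fun k hk =>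
    ⟨by omega, dif_pos (by omega)⟩
  obtain ⟨k, hkN, hk⟩ := exists_abs_logRatio_sub_le (x := x) (N := m / 2 - 1) ht hM
    (by
      obtain ⟨h, hx0⟩ := hx 0 (Nat.zero_le _)
      rw [hx0]
      simpa [hc0, ncard_conjugatesOf_one] using hstep 0 h)
    (fun k hk => by
      obtain ⟨h, h1⟩ := hx k hk.le
      obtain ⟨h', h2⟩ := hx (k + 1) hk
      rw [h1, h2]
      exact hstep (k + 1) h')
    (by
      obtain ⟨h, h1⟩ := hx _ le_rfl
      rw [h1]
      refine (card_centralizer_le_map (alternatingGroup (Fin (m + 1))).subtype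
        (Subgroup.subtype_injective _) _).trans ?_
      refine (card_centralizer_cycleRange_le h (by omega)).trans ?_
      exact Nat.pow_le_pow_right (by omega) (by norm_num)) hβ
  refine ⟨x k, ?_, hk⟩
  obtain ⟨h, h1⟩ := hx k hkN
  rw [h1]
  exact Fin.isCycle_cycleRange (by simp [Fin.ext_iff])

theorem pow_le_card_alternatingGroup {n t : ℕ} (hn : 16 * t + 4 ≤ n) :
    (n ^ 4) ^ t ≤ Nat.card (alternatingGroup (Fin n)) := by
  have : Nontrivial (Fin n) := Fin.nontrivial_iff_two_le.2 (by omega)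
  have h2 := two_mul_nat_card_alternatingGroup (α := Fin n)
  rw [Nat.card_perm, Nat.card_fin] at h2
  obtain ⟨a, ha⟩ : ∃ a, n + 1 - (8 * t + 2) = a := ⟨_, rfl⟩
  have hsq : n ≤ a ^ 2 := by nlinarith [show n ≤ 2 * a by omega, show 2 ≤ a by omega]
  have h3 : n ^ (4 * t + 1) ≤ n.factorial := by
    calc n ^ (4 * t + 1) ≤ (a ^ 2) ^ (4 * t + 1) := Nat.pow_le_pow_left hsq _
      _ = (n + 1 - (8 * t + 2)) ^ (8 * t + 2) := by rw [ha, ← pow_mul]; ring_nf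
      _ ≤ n.descFactorial (8 * t + 2) := Nat.pow_sub_le_descFactorial _ _
      _ ≤ n.factorial := by
        rw [← Nat.factorial_mul_descFactorial (show 8 * t + 2 ≤ n by omega)]
        exact Nat.le_mul_of_pos_left _ (Nat.factorial_pos _)
  rw [← pow_mul]
  have h4 : 2 * n ^ (4 * t) ≤ n ^ (4 * t + 1) := by
    rw [pow_succ, mul_comm]
    exact Nat.mul_le_mul_left _ (by omega)
  omega

/-! ### Linear groups containing permutations of a spanning family -/

section PermRep

variable {K V G J : Type*} [Field K] [AddCommGroup V] [Module K V] [Group G] {m : ℕ}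

/-- A representation `ρ` of `G`, restricted along a homomorphism `φ` from a symmetric group,
permutes the vectors `w j i` with fixed `j` through their second index, and these vectors span. -/
structure PermutesSpanning (ρ : G →* Module.End K V) (φ : Equiv.Perm (Fin (m + 1)) →* G)
    (w : J → Fin (m + 1) → V) : Prop where
  injective : Function.Injective ρ
  apply : ∀ σ j i, ρ (φ σ) (w j i) = w j (σ i)
  span_eq_top : Submodule.span K (Set.range fun p : J × Fin (m + 1) => w p.1 p.2) = ⊤

variable {ρ : G →* Module.End K V} {φ : Equiv.Perm (Fin (m + 1)) →* G} {w : J → Fin (m + 1) → V}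

theorem PermutesSpanning.ext (h : PermutesSpanning ρ φ w) {x y : G}
    (hxy : ∀ j i, ρ x (w j i) = ρ y (w j i)) : x = y := by
  refine h.injective (LinearMap.ext_on_range h.span_eq_top ?_)
  rintro ⟨j, i⟩
  exact hxy j i

/-- The square of a long cycle has at most two orbits, so an element commuting with it is
determined by its values at the `2 * |J|` vectors `w j 0`, `w j 1`. -/
theorem PermutesSpanning.card_centralizer_le [Finite V] [Fintype J]
    (h : PermutesSpanning ρ φ w) :
    Nat.card (Subgroup.centralizer {φ (Equiv.addRight 2)}) ≤
      Nat.card V ^ (2 * Fintype.card J) := by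
  have hcard : Nat.card (J → V × V) = Nat.card V ^ (2 * Fintype.card J) := by
    rw [Nat.card_fun, Nat.card_prod, ← sq, ← pow_mul, Nat.card_eq_fintype_card (α := J)]
  rw [← hcard]
  refine Nat.card_le_card_of_injective (fun x j => (ρ x.1 (w j 0), ρ x.1 (w j 1))) ?_
  intro x y hxy
  have hx := Subgroup.mem_centralizer_singleton_iff.1 x.2
  have hy := Subgroup.mem_centralizer_singleton_iff.1 y.2
  have key : ∀ j (k : ℕ) (hk : k < m + 1), ρ x.1 (w j ⟨k, hk⟩) = ρ y.1 (w j ⟨k, hk⟩) := by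
    intro j k
    have h01 := congrFun hxy j
    simp only [Prod.mk.injEq] at h01
    induction k using Nat.twoStepInduction with
    | zero => exact fun _ => h01.1
    | one =>
      intro hk
      have h1 : (⟨1, hk⟩ : Fin (m + 1)) = 1 := Fin.ext (Nat.mod_eq_of_lt hk).symm
      rw [h1]
      exact h01.2
    | more k ih _ =>
      intro hk
      have hk2 : (⟨k, by omega⟩ + 2 : Fin (m + 1)) = ⟨k + 2, hk⟩ := by
        refine Fin.ext ?_
        change (k + 2 % (m + 1)) % (m + 1) = k + 2
        rw [Nat.mod_eq_of_lt (a := 2) (by omega), Nat.mod_eq_of_lt hk]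
      have hw : w j ⟨k + 2, hk⟩ = ρ (φ (Equiv.addRight 2)) (w j ⟨k, by omega⟩) := by
        rw [h.apply]
        exact congrArg (w j) hk2.symm
      rw [hw, ← Module.End.mul_apply, ← Module.End.mul_apply, ← map_mul, ← map_mul, hx, hy,
        map_mul, map_mul, Module.End.mul_apply, Module.End.mul_apply, ih]
  exact Subtype.ext (h.ext fun j i => key j i.1 i.2)

/-- A transposition differs from the identity by an operator of rank at most `|J|`, and there are
few such operators. -/
theorem PermutesSpanning.ncard_conjugatesOf_swap_le [Finite K] [Finite V] [Fintype J]
    (h : PermutesSpanning ρ φ w) (a b : Fin (m + 1)) :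
    (conjugatesOf (φ (Equiv.swap a b))).ncard ≤ Nat.card V ^ (2 * Fintype.card J) := by
  have : Module.Finite K V := Module.Finite.of_finite
  let A : (J → K) →ₗ[K] V := Fintype.linearCombination K fun j => w j b - w j a
  have hA : ∀ v, (ρ (φ (Equiv.swap a b)) - 1) v ∈ LinearMap.range A := by
    intro v
    have hv : v ∈ Submodule.span K (Set.range fun p : J × Fin (m + 1) => w p.1 p.2) := by
      rw [h.span_eq_top]; trivial
    have hd : ∀ j, w j b - w j a ∈ LinearMap.range A := fun j => by
      rw [Fintype.range_linearCombination]
      exact Submodule.subset_span ⟨j, rfl⟩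
    induction hv using Submodule.span_induction with
    | mem v hv =>
      obtain ⟨⟨j, i⟩, rfl⟩ := hv
      change (ρ (φ (Equiv.swap a b)) - 1) (w j i) ∈ _
      rw [LinearMap.sub_apply, h.apply, Module.End.one_apply, Equiv.swap_apply_def]
      split_ifs with h1 h2
      · rw [h1]; exact hd j
      · rw [h2, ← neg_sub]; exact Submodule.neg_mem _ (hd j)
      · rw [sub_self]; exact Submodule.zero_mem _
    | zero => rw [map_zero]; exact Submodule.zero_mem _
    | add u v _ _ hu hv => rw [map_add]; exact Submodule.add_mem _ hu hv
    | smul c v _ hv => rw [map_smul]; exact Submodule.smul_mem _ _ hv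
  obtain ⟨s, hs⟩ := A.rangeRestrict.exists_rightInverse_of_surjective
    (LinearMap.range_rangeRestrict A)
  let B : V →ₗ[K] (J → K) := s ∘ₗ (ρ (φ (Equiv.swap a b)) - 1).codRestrict _ hA
  have hAB : A ∘ₗ B = ρ (φ (Equiv.swap a b)) - 1 := by
    ext v
    exact congrArg Subtype.val
      (LinearMap.congr_fun hs ((ρ (φ (Equiv.swap a b)) - 1).codRestrict _ hA v))
  have hfin1 : Finite ((J → K) →ₗ[K] V) := Module.finite_of_finite K
  have hfin2 : Finite (V →ₗ[K] (J → K)) := Module.finite_of_finite K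
  have hsub : ρ '' conjugatesOf (φ (Equiv.swap a b)) ⊆
      Set.range fun p : ((J → K) →ₗ[K] V) × (V →ₗ[K] (J → K)) => 1 + p.1 ∘ₗ p.2 := by
    rintro _ ⟨x, hx, rfl⟩
    obtain ⟨c, rfl⟩ := isConj_iff.1 (show IsConj (φ (Equiv.swap a b)) x from hx)
    refine ⟨(ρ c ∘ₗ A, B ∘ₗ ρ c⁻¹), ?_⟩
    have h1 : (ρ c ∘ₗ A) ∘ₗ B ∘ₗ ρ c⁻¹ = ρ c * (A ∘ₗ B) * ρ c⁻¹ := rfl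
    have h2 : ρ c * ρ c⁻¹ = 1 := by rw [← map_mul, mul_inv_cancel, map_one]
    simp only [h1, hAB, mul_sub, sub_mul, mul_one, h2, map_mul]
    abel
  rw [← Set.ncard_image_of_injective _ h.injective]
  refine (Set.ncard_le_ncard hsub (Set.finite_range _)).trans ?_
  rw [← Set.image_univ]
  refine (Set.ncard_image_le (Set.toFinite _)).trans_eq ?_
  rw [Set.ncard_univ, Nat.card_prod, Module.natCard_eq_pow_finrank (K := K),
    Module.natCard_eq_pow_finrank (K := K) (V := V →ₗ[K] (J → K)),
    Module.natCard_eq_pow_finrank (K := K) (V := V), Module.finrank_linearMap,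
    Module.finrank_linearMap, Module.finrank_fintype_fun_eq_card, ← pow_add, ← pow_mul]
  ring_nf

open scoped commutatorElement in
/-- Translation by `2` is the commutator of translation by `1` with negation. -/
theorem commutatorElement_addRight_neg :
    ⁅(Equiv.addRight 1 : Equiv.Perm (Fin (m + 1))), Equiv.neg (Fin (m + 1))⁆ =
      Equiv.addRight 2 := by
  ext1 x
  rw [commutatorElement_def, Equiv.Perm.mul_apply, Equiv.Perm.mul_apply, Equiv.Perm.mul_apply,
    Equiv.Perm.inv_def, Equiv.Perm.inv_def]
  simp only [Equiv.neg_symm, Equiv.neg_apply, Equiv.addRight_symm, Equiv.coe_addRight]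
  have h2 : (1 + 1 : Fin (m + 1)) = 2 := Fin.ext (by simp [Fin.val_add])
  rw [neg_add, neg_neg, neg_neg, add_assoc, h2]

open scoped commutatorElement in
/-- The element with small centralizer is the square of a long cycle, the one with small class a
commutator of two transpositions. Both are commutators in `G`, so they lie in `H`. -/
theorem PermutesSpanning.hasSpread_modCenter {H : Type*} [Group H] [Finite K] [Finite V]
    [Finite G] [Fintype J] (h : PermutesSpanning ρ φ w) (hw : ∃ j, Function.Injective (w j))
    (hm : 4 ≤ m) (f : H →* G) (hf : Function.Injective f) (hG : commutator G ≤ f.range) {t : ℕ}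
    (ht : (Nat.card V ^ (4 * Fintype.card J)) ^ (t + 2) ≤ Nat.card G) :
    HasSpread (ModCenter H) t := by
  have hcomm : ∀ σ τ : Equiv.Perm (Fin (m + 1)), ∃ x, f x = φ ⁅σ, τ⁆ := fun σ τ => by
    rw [map_commutatorElement]
    exact hG (Subgroup.commutator_mem_commutator (Subgroup.mem_top _) (Subgroup.mem_top _))
  obtain ⟨g, hg⟩ := hcomm (Equiv.addRight 1) (Equiv.neg _)
  obtain ⟨y, hy⟩ := hcomm (Equiv.swap 0 1) (Equiv.swap 1 2)
  rw [commutatorElement_addRight_neg] at hg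
  have hVpos : 0 < Nat.card V := Nat.card_pos
  refine FinSimple.hasSpread_modCenter f hf hG (g := g) (h := y) ?_ ?_ ?_ ht
  · rw [hg]
    exact h.card_centralizer_le.trans (Nat.pow_le_pow_right hVpos (by omega))
  · rw [hy, map_commutatorElement]
    refine (ncard_conjugatesOf_commutatorElement_le _ _).trans
      ((Nat.pow_le_pow_left (h.ncard_conjugatesOf_swap_le 0 1) 2).trans_eq ?_)
    rw [← pow_mul]
    ring_nf
  · -- The two products of the translation and the 3-cycle differ at the point `-2`.
    intro hc
    obtain ⟨j, hj⟩ := hw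
    have h1 := congrArg f (Subgroup.mem_center_iff.1 hc g)
    rw [map_mul, map_mul, hg, hy, ← map_mul, ← map_mul] at h1
    have h2 := congrArg (fun x => ρ x (w j (-2))) h1
    simp only [h.apply] at h2
    have h3 := hj h2
    have v1 : (1 : Fin (m + 1)).1 = 1 :=
      show 1 % (m + 1) = 1 from Nat.mod_eq_of_lt (by omega)
    have v2 : (2 : Fin (m + 1)).1 = 2 :=
      show 2 % (m + 1) = 2 from Nat.mod_eq_of_lt (by omega)
    have v0 : (0 : Fin (m + 1)).1 = 0 := rfl
    have vn : (-2 : Fin (m + 1)).1 = m - 1 := by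
      rw [Fin.val_neg, if_neg (fun h => by rw [Fin.ext_iff, v2, v0] at h; omega), v2]
      omega
    have hne : ∀ {a b : Fin (m + 1)}, a.1 ≠ b.1 → a ≠ b := fun h h' => h (congrArg _ h')
    have n0 : (-2 : Fin (m + 1)) ≠ 0 := hne (by rw [vn, v0]; omega)
    have n1 : (-2 : Fin (m + 1)) ≠ 1 := hne (by rw [vn, v1]; omega)
    have n2 : (-2 : Fin (m + 1)) ≠ 2 := hne (by rw [vn, v2]; omega)
    have n01 : (0 : Fin (m + 1)) ≠ 1 := hne (by rw [v0, v1]; omega)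
    have n02 : (0 : Fin (m + 1)) ≠ 2 := hne (by rw [v0, v2]; omega)
    have n12 : (1 : Fin (m + 1)) ≠ 2 := hne (by rw [v1, v2]; omega)
    rw [commutatorElement_def] at h3
    simp only [Equiv.Perm.mul_apply, Equiv.swap_inv, Equiv.coe_addRight, neg_add_cancel,
      Equiv.swap_apply_of_ne_of_ne n1 n2, Equiv.swap_apply_of_ne_of_ne n0 n1,
      Equiv.swap_apply_of_ne_of_ne n01 n02, Equiv.swap_apply_left,
      Equiv.swap_apply_of_ne_of_ne n02.symm n12.symm] at h3
    exact n02 h3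

end PermRep

/-! ### Strictly triangular matrices -/

section StrictLower

variable {n : ℕ}

/-- The index type of the positions strictly below the diagonal. -/
abbrev LowerIndex (n : ℕ) : Type := Σ i : Fin n, Fin i.1

/-- The strictly lower triangular matrix with prescribed entries below the diagonal. -/
def strictLower {K : Type*} [Zero K] (c : LowerIndex n → K) : Matrix (Fin n) (Fin n) K :=
  Matrix.of fun i j => if h : j.1 < i.1 then c ⟨i, ⟨j.1, h⟩⟩ else 0

theorem strictLower_apply_of_le {K : Type*} [Zero K] (c : LowerIndex n → K) {i j : Fin n}
    (h : i ≤ j) :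
    strictLower c i j = 0 :=
  dif_neg (not_lt.2 (Fin.le_def.1 h))

theorem eq_of_strictLower {K : Type*} [Zero K] {c d : LowerIndex n → K}
    (h : ∀ i j, j < i → strictLower c i j = strictLower d i j) : c = d := by
  funext ⟨i, j, hj⟩
  have := h i ⟨j, hj.trans i.2⟩ (Fin.lt_def.2 hj)
  rwa [strictLower, strictLower, Matrix.of_apply, Matrix.of_apply, dif_pos hj, dif_pos hj] at this

theorem card_lowerIndex_fun {K : Type*} [Finite K] :
    Nat.card (LowerIndex n → K) = Nat.card K ^ (n * (n - 1) / 2) := by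
  rw [Nat.card_fun, Nat.card_sigma]
  simp only [Nat.card_fin]
  rw [Fin.sum_univ_eq_sum_range fun i => i, Finset.sum_range_id]

/-- The comparison of exponents behind all the families: the space has dimension linear in `n`,
while the logarithm of the group order is quadratic in `n`. -/
theorem pow_card_le_of_injective {K G V : Type*} [Field K] [AddCommGroup V] [Module K V]
    [Module.Finite K V] [Finite K] [Finite G] (u : (LowerIndex n → K) → G)
    (hu : Function.Injective u) {a t : ℕ}
    (ha : a * Module.finrank K V * (t + 2) ≤ n * (n - 1) / 2) :
    (Nat.card V ^ a) ^ (t + 2) ≤ Nat.card G := by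
  refine le_trans ?_ (Nat.card_le_card_of_injective u hu)
  rw [card_lowerIndex_fun, Module.natCard_eq_pow_finrank (K := K), ← pow_mul, ← pow_mul]
  refine Nat.pow_le_pow_right Nat.card_pos ?_
  rwa [mul_comm, mul_right_comm]

end StrictLower

/-! ### Linear and unitary groups -/

section MatrixGroups

variable {K : Type*} [Field K] {m : ℕ}

theorem permMatrixHom_mulVec_single {ι : Type*} [Fintype ι] [DecidableEq ι] (σ : Equiv.Perm ι)
    (i : ι) : (Matrix.permMatrixHom σ : Matrix ι ι K).mulVec (Pi.single i 1) =
      Pi.single (σ i) 1 := by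
  rw [Matrix.permMatrixHom_apply, Matrix.permMatrix_mulVec]
  ext j
  simp only [Function.comp_apply, Pi.single_apply, Equiv.Perm.inv_eq_iff_eq]

theorem permutesSpanning_matrix {G : Type*} [Group G]
    (ψ : G →* Matrix (Fin (m + 1)) (Fin (m + 1)) K) (hψ : Function.Injective ψ)
    (φ : Equiv.Perm (Fin (m + 1)) →* G) (hφ : ∀ σ, ψ (φ σ) = Matrix.permMatrixHom σ) :
    PermutesSpanning ((Matrix.toLinAlgEquiv' : _ ≃ₐ[K] _).toMonoidHom.comp ψ) φ
      (fun (_ : Unit) i => (Pi.single i 1 : Fin (m + 1) → K)) where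
  injective := (Matrix.toLinAlgEquiv' (R := K)).injective.comp hψ
  apply σ _ i := by
    change Matrix.toLinAlgEquiv' (ψ (φ σ)) (Pi.single i 1) = _
    rw [hφ, Matrix.toLinAlgEquiv'_apply, permMatrixHom_mulVec_single]
  span_eq_top := by
    rw [eq_top_iff, ← (Pi.basisFun K (Fin (m + 1))).span_eq]
    refine Submodule.span_mono ?_
    rintro _ ⟨i, rfl⟩
    exact ⟨((), i), by simp⟩

/-- The transfer to central quotients for matrix groups containing the permutation matrices. -/
theorem hasSpread_modCenter_matrix [Finite K] {G H : Type*} [Group G] [Group H]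
    (ψ : G →* Matrix (Fin (m + 1)) (Fin (m + 1)) K) (hψ : Function.Injective ψ)
    (φ : Equiv.Perm (Fin (m + 1)) →* G) (hφ : ∀ σ, ψ (φ σ) = Matrix.permMatrixHom σ)
    (f : H →* G) (hf : Function.Injective f) (hG : commutator G ≤ f.range) (hm : 4 ≤ m)
    {n : ℕ} (u : (LowerIndex n → K) → G) (hu : Function.Injective u) {t : ℕ}
    (ht : 4 * (m + 1) * (t + 2) ≤ n * (n - 1) / 2) :
    HasSpread (ModCenter H) t := by
  have : Finite G := Finite.of_injective ψ hψ
  refine (permutesSpanning_matrix ψ hψ φ hφ).hasSpread_modCenter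
    ⟨(), fun i j h => ?_⟩ hm f hf hG (pow_card_le_of_injective u hu (by simpa using ht))
  by_contra hij
  have := congrFun h i
  simp [hij] at this

theorem hasSpread_projectiveSpecialLinearGroup [Finite K] {t : ℕ} (hm : 8 * (t + 2) ≤ m) :
    HasSpread (Matrix.ProjectiveSpecialLinearGroup (Fin (m + 1)) K) t := by
  have hdet : ∀ c : LowerIndex (m + 1) → K, (1 + strictLower c).det = 1 := by
    intro c
    rw [Matrix.det_of_isLowerTriangular]
    · simp [strictLower_apply_of_le]
    · intro i j hij
      have hij' : i < j := hij
      simp [strictLower_apply_of_le c hij'.le, hij'.ne]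
  refine hasSpread_modCenter_matrix (K := K) (G := Matrix.GeneralLinearGroup (Fin (m + 1)) K)
    (Units.coeHom _) Units.val_injective (Matrix.permMatrixHom.toHomUnits) (fun _ => rfl)
    Matrix.SpecialLinearGroup.toGL
    (fun x y h => Subtype.ext (congrArg Units.val h)) ?_ (by omega) (n := m + 1)
    (fun c => Matrix.GeneralLinearGroup.mkOfDetNeZero (1 + strictLower c)
      (by rw [hdet]; exact one_ne_zero)) ?_ ?_
  · intro x hx
    have h1 := Abelianization.commutator_subset_ker
      (Matrix.GeneralLinearGroup.det (n := Fin (m + 1)) (R := K)) hx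
    have h2 : (x : Matrix (Fin (m + 1)) (Fin (m + 1)) K).det = 1 := congrArg Units.val h1
    exact ⟨⟨x, h2⟩, Units.ext rfl⟩
  · intro c d h
    have h1 : (1 + strictLower c) = 1 + strictLower d := congrArg Units.val h
    have h2 : strictLower c = strictLower d := add_left_cancel h1
    exact eq_of_strictLower fun i j _ => congrFun (congrFun h2 i) j
  · rw [Nat.le_div_iff_mul_le two_pos, Nat.add_sub_cancel]
    nlinarith

/-- In positive characteristic `-1` is a sum of two squares in the prime field, whose elements
every involution fixes. -/
theorem exists_star_eq_self_one_add_sq_add_sq [Finite K] [StarRing K] :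
    ∃ x y : K, star x = x ∧ star y = y ∧ 1 + x * x + y * y = 0 := by
  obtain ⟨p, hp⟩ := CharP.exists K
  have : NeZero p := ⟨CharP.char_ne_zero_of_finite K p⟩
  obtain ⟨a, b, hab⟩ := CharP.sq_add_sq K p (-1)
  refine ⟨a, b, star_natCast a, star_natCast b, ?_⟩
  push_cast at hab
  linear_combination hab

open Matrix in
/-- The unitary group contains the elements `1 + P B Pᴴ` with `Pᴴ P = 0` and `B` skew-Hermitian,
for a matrix `P` whose columns are supported on disjoint triples of coordinates. -/
theorem exists_injective_unitaryGroup [Finite K] [StarRing K] {n k : ℕ} (hk : 3 * k ≤ n) :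
    ∃ u : (LowerIndex k → K) → Matrix.unitaryGroup (Fin n) K, Function.Injective u := by
  obtain ⟨x, y, hx, hy, hxy⟩ := exists_star_eq_self_one_add_sq_add_sq (K := K)
  let e : Fin 3 → Fin k → Fin n := fun l i => ⟨l.1 * k + i.1, by
    have := l.2; have := i.2; nlinarith⟩
  let E : Fin 3 → Matrix (Fin n) (Fin k) K := fun l =>
    (1 : Matrix (Fin n) (Fin n) K).submatrix id (e l)
  have hE : ∀ l l', (E l)ᴴ * E l' = if l = l' then 1 else 0 := by
    intro l l'
    have h1 : (E l)ᴴ * E l' = (1 : Matrix (Fin n) (Fin n) K).submatrix (e l) (e l') := by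
      rw [show (E l)ᴴ = (1 : Matrix (Fin n) (Fin n) K).submatrix (e l) (Equiv.refl _) by
          simp [E, conjTranspose_submatrix],
        show E l' = (1 : Matrix (Fin n) (Fin n) K).submatrix (Equiv.refl _) (e l') from rfl,
        submatrix_mul_equiv, one_mul]
    rw [h1]
    ext i j
    have hv : (e l i = e l' j) ↔ (l = l' ∧ i = j) := by
      have hi := i.2
      have hj := j.2
      simp only [e, Fin.ext_iff]
      constructor
      · intro h
        have h2 : l.1 = l'.1 := by
          have h3 := congrArg (· / k) h
          beta_reduce at h3
          rwa [mul_comm, Nat.mul_add_div (by omega), Nat.div_eq_of_lt hi, mul_comm l'.1,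
            Nat.mul_add_div (by omega), Nat.div_eq_of_lt hj] at h3
        rw [h2] at h
        exact ⟨h2, by omega⟩
      · rintro ⟨h2, h3⟩
        rw [h2, h3]
    by_cases hl : l = l'
    · rw [if_pos hl, submatrix_apply, one_apply, one_apply]
      exact if_congr (hv.trans (and_iff_right hl)) rfl rfl
    · simp [hl, one_apply, hv]
  let P := E 0 + x • E 1 + y • E 2
  have hPP : Pᴴ * P = 0 := by
    simp only [P, conjTranspose_add, conjTranspose_smul, hx, hy, Matrix.add_mul, Matrix.mul_add,
      Matrix.smul_mul, Matrix.mul_smul, hE]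
    simp only [Fin.reduceEq, if_true, if_false, smul_zero, add_zero, zero_add, smul_smul]
    rw [← one_smul K (1 : Matrix (Fin k) (Fin k) K), smul_smul, smul_smul, ← add_smul, ← add_smul]
    simp [hxy]
  have hEP : (E 0)ᴴ * P = 1 := by
    simp [P, Matrix.mul_add, hE]
  have hPE : Pᴴ * E 0 = 1 := by
    rw [← conjTranspose_one, ← hEP, conjTranspose_mul, conjTranspose_conjTranspose]
  let B : (LowerIndex k → K) → Matrix (Fin k) (Fin k) K := fun c =>
    strictLower c - (strictLower c)ᴴ
  have hB : ∀ c, (B c)ᴴ = - B c := fun c => by simp [B]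
  refine ⟨fun c => ⟨1 + P * B c * Pᴴ, mem_unitaryGroup_iff.2 ?_⟩, ?_⟩
  · have h1 : (P * B c * Pᴴ) * (P * B c * Pᴴ) = 0 := by
      rw [show (P * B c * Pᴴ) * (P * B c * Pᴴ) = P * B c * (Pᴴ * P) * B c * Pᴴ by
        simp only [Matrix.mul_assoc], hPP]
      simp
    have h2 : star (1 + P * B c * Pᴴ) = 1 - P * B c * Pᴴ := by
      rw [star_eq_conjTranspose, conjTranspose_add, conjTranspose_one, conjTranspose_mul,
        conjTranspose_mul, conjTranspose_conjTranspose, hB, Matrix.neg_mul, Matrix.mul_neg,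
        Matrix.mul_assoc, sub_eq_add_neg]
    rw [h2, add_mul, mul_sub, mul_sub, h1]
    simp
  · intro c d h
    have h1 : P * B c * Pᴴ = P * B d * Pᴴ := add_left_cancel (congrArg Subtype.val h)
    have h2 : ∀ c, (E 0)ᴴ * (P * B c * Pᴴ) * E 0 = B c := fun c => by
      rw [show (E 0)ᴴ * (P * B c * Pᴴ) * E 0 = ((E 0)ᴴ * P) * B c * (Pᴴ * E 0) by
        simp only [Matrix.mul_assoc], hEP, hPE, one_mul, mul_one]
    have h3 : B c = B d := by rw [← h2, h1, h2]
    refine eq_of_strictLower fun i j hij => ?_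
    have h4 := congrFun (congrFun h3 i) j
    simpa [B, strictLower_apply_of_le _ hij.le] using h4

theorem hasSpread_specialUnitaryGroup [Finite K] [StarRing K] {t : ℕ} (hm : 128 * (t + 2) ≤ m) :
    HasSpread (ModCenter (Matrix.specialUnitaryGroup (Fin (m + 1)) K)) t := by
  obtain ⟨k, hk⟩ : ∃ k, (m + 1) / 3 = k := ⟨_, rfl⟩
  obtain ⟨u, hu⟩ := exists_injective_unitaryGroup (K := K) (n := m + 1) (k := k) (by omega)
  let D : Matrix.unitaryGroup (Fin (m + 1)) K →* Kˣ :=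
    (Matrix.detMonoidHom.comp (Matrix.unitaryGroup (Fin (m + 1)) K).subtype).toHomUnits
  refine hasSpread_modCenter_matrix (Matrix.unitaryGroup (Fin (m + 1)) K).subtype
    Subtype.val_injective
    (Matrix.permMatrixHom.codRestrict _ fun σ => Matrix.mem_unitaryGroup_iff.2 ?_) (fun _ => rfl)
    (Submonoid.inclusion Matrix.specialUnitaryGroup_le_unitaryGroup)
    (Submonoid.inclusion_injective _) ?_ (by omega) u hu ?_
  · rw [Matrix.permMatrixHom_apply, Matrix.star_eq_conjTranspose,
      Matrix.conjTranspose_permMatrix, ← Matrix.permMatrix_mul]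
    simp
  · intro x hx
    have h1 : D x = 1 := Abelianization.commutator_subset_ker D hx
    exact ⟨⟨x.1, x.2, congrArg Units.val h1⟩, rfl⟩
  · rw [Nat.le_div_iff_mul_le two_pos]
    have h1 : m + 1 ≤ 4 * k := by omega
    have h2 : 32 * (t + 2) ≤ k - 1 := by omega
    calc 4 * (m + 1) * (t + 2) * 2 = (m + 1) * (8 * (t + 2)) := by ring
      _ ≤ (4 * k) * (8 * (t + 2)) := Nat.mul_le_mul_right _ h1
      _ = k * (32 * (t + 2)) := by ring
      _ ≤ _ := Nat.mul_le_mul_left _ h2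

end MatrixGroups

/-! ### Symplectic groups -/

section Symplectic

variable {K : Type*} [Field K] {m : ℕ}

open Matrix in
/-- Permutation matrices as symplectic matrices, through the Levi subgroup of matrices
`diag(P, P⁻ᵀ)`. -/
def permSymplectic (K : Type*) [Field K] (n : ℕ) :
    Equiv.Perm (Fin n) →* symplecticGroup (Fin n) K where
  toFun σ := ⟨fromBlocks (permMatrixHom σ) 0 0 (permMatrixHom σ), by
    rw [SymplecticGroup.fromBlocks_mem_iff, permMatrixHom_apply, transpose_permMatrix,
      ← permMatrix_mul]
    simp⟩
  map_one' := Subtype.ext (by simp)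
  map_mul' σ τ := Subtype.ext (by
    simp only [map_mul, Submonoid.coe_mul, fromBlocks_multiply]
    simp)

/-- The standard basis, as two copies of the permutation basis. -/
def symplecticBasis (K : Type*) [Field K] (n : ℕ) (b : Bool) (i : Fin n) : Fin n ⊕ Fin n → K :=
  Pi.single (if b then Sum.inl i else Sum.inr i) 1

open Matrix in
theorem permutesSpanning_symplectic :
    PermutesSpanning ((toLinAlgEquiv' : _ ≃ₐ[K] _).toMonoidHom.comp
      (symplecticGroup (Fin (m + 1)) K).subtype) (permSymplectic K (m + 1))
      (symplecticBasis K (m + 1)) where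
  injective := (toLinAlgEquiv' (R := K)).injective.comp Subtype.val_injective
  apply σ b i := by
    change (fromBlocks (permMatrixHom σ) 0 0 (permMatrixHom σ)).mulVec _ = _
    have h := permMatrixHom_mulVec_single (K := K) σ i
    cases b
    · have h1 : symplecticBasis K (m + 1) false = 
          fun i => Sum.elim (0 : Fin (m + 1) → K) (Pi.single i 1) := by
        funext i
        exact (Sum.elim_zero_single i 1).symm
      simp only [h1, fromBlocks_mulVec, Sum.elim_comp_inl, Sum.elim_comp_inr, h, zero_mulVec,
        mulVec_zero, zero_add]
    · have h1 : symplecticBasis K (m + 1) true = 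
          fun i => Sum.elim (Pi.single i 1) (0 : Fin (m + 1) → K) := by
        funext i
        exact (Sum.elim_single_zero i 1).symm
      simp only [h1, fromBlocks_mulVec, Sum.elim_comp_inl, Sum.elim_comp_inr, h, zero_mulVec,
        mulVec_zero, add_zero]
  span_eq_top := by
    rw [eq_top_iff, ← (Pi.basisFun K (Fin (m + 1) ⊕ Fin (m + 1))).span_eq]
    refine Submodule.span_mono ?_
    rintro _ ⟨i | i, rfl⟩
    · exact ⟨(true, i), by simp [symplecticBasis]⟩
    · exact ⟨(false, i), by simp [symplecticBasis]⟩

open Matrix in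
theorem hasSpread_symplecticGroup [Finite K] {t : ℕ} (hm : 32 * (t + 2) ≤ m) :
    HasSpread (ModCenter (symplecticGroup (Fin (m + 1)) K)) t := by
  have : Finite (symplecticGroup (Fin (m + 1)) K) := Finite.of_injective _ Subtype.val_injective
  let u : (LowerIndex (m + 1) → K) → symplecticGroup (Fin (m + 1)) K := fun c =>
    ⟨fromBlocks 1 (strictLower c + (strictLower c)ᵀ) 0 1, by
      rw [SymplecticGroup.fromBlocks_mem_iff]
      simp [add_comm]⟩
  have hu : Function.Injective u := by
    intro c d h
    have h1 := (fromBlocks_inj.1 (congrArg Subtype.val h)).2.1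
    refine eq_of_strictLower fun i j hij => ?_
    have h2 := congrFun (congrFun h1 i) j
    simpa [strictLower_apply_of_le _ hij.le] using h2
  refine permutesSpanning_symplectic.hasSpread_modCenter ⟨true, fun i j h => ?_⟩ (by omega)
    (MonoidHom.id _) Function.injective_id (fun x _ => ⟨x, rfl⟩)
    (pow_card_le_of_injective u hu ?_)
  · by_contra hij
    have := congrFun h (Sum.inl i)
    simp [symplecticBasis, hij] at this
  · rw [Nat.le_div_iff_mul_le two_pos]
    simp only [Fintype.card_bool, Module.finrank_fintype_fun_eq_card, Fintype.card_sum,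
      Fintype.card_fin, Nat.add_sub_cancel]
    calc _ = (m + 1) * (32 * (t + 2)) := by ring
      _ ≤ _ := Nat.mul_le_mul_left _ hm

end Symplectic

/-! ### Orthogonal groups -/

section Orthogonal

variable {K : Type} [Field K]

/-- The natural representation of an orthogonal group. -/
def orthogonalRep {V : Type*} [AddCommGroup V] [Module K V] (Q : QuadraticForm K V) :
    orthogonalGroup Q →* Module.End K V :=
  LinearEquiv.automorphismGroup.toLinearMapMonoidHom.comp (orthogonalGroup Q).subtype

theorem orthogonalRep_injective {V : Type*} [AddCommGroup V] [Module K V]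
    (Q : QuadraticForm K V) : Function.Injective (orthogonalRep Q) := fun _ _ h =>
  Subtype.ext (LinearEquiv.ext fun v => LinearMap.congr_fun h v)

/-- Permutations of the coordinates of `Kⁿ` act on `(Kⁿ)* × Kⁿ` and preserve the hyperbolic
form. -/
def permHyperbolic (K : Type) [Field K] (n : ℕ) :
    Equiv.Perm (Fin n) →* orthogonalGroup (hyperbolicForm K n) where
  toFun σ := ⟨LinearEquiv.prodCongr
    (LinearEquiv.funCongrLeft K K σ).dualMap (LinearEquiv.funCongrLeft K K σ.symm), by
      rintro ⟨f, x⟩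
      change f (fun i => x (σ.symm (σ i))) = f x
      simp⟩
  map_one' := rfl
  map_mul' _ _ := rfl

/-- The coordinate functions and the standard basis vectors in `(Kⁿ)* × Kⁿ`. -/
def hyperbolicBasis (K : Type) [Field K] (n : ℕ) (b : Bool) (i : Fin n) :
    Module.Dual K (Fin n → K) × (Fin n → K) :=
  if b then (0, Pi.single i 1) else (LinearMap.proj i, 0)

theorem permHyperbolic_apply {n : ℕ} (σ : Equiv.Perm (Fin n)) (b : Bool) (i : Fin n) :
    (permHyperbolic K n σ).1 (hyperbolicBasis K n b i) = hyperbolicBasis K n b (σ i) := by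
  cases b
  · exact Prod.ext (LinearMap.ext fun _ => rfl) (funext fun _ => rfl)
  · refine Prod.ext (LinearMap.ext fun _ => rfl) (funext fun j => ?_)
    change (Pi.single i 1 : Fin n → K) (σ.symm j) = (Pi.single (σ i) 1 : Fin n → K) j
    simp only [Pi.single_apply, Equiv.symm_apply_eq]

theorem span_hyperbolicBasis (n : ℕ) :
    Submodule.span K (Set.range fun p : Bool × Fin n => hyperbolicBasis K n p.1 p.2) = ⊤ := by
  rw [eq_top_iff]
  rintro ⟨f, x⟩ -
  have hx : ((0 : Module.Dual K (Fin n → K)), x) =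
      ∑ i, x i • hyperbolicBasis K n true i := by
    refine Prod.ext ?_ ?_
    · simp [hyperbolicBasis, Prod.fst_sum]
    · simp only [hyperbolicBasis, Prod.snd_sum, if_true, Prod.smul_snd]
      exact pi_eq_sum_univ' x
  have hf : (f, (0 : Fin n → K)) =
      ∑ i, f (Pi.single i 1) • hyperbolicBasis K n false i := by
    refine Prod.ext ?_ ?_
    · simp only [hyperbolicBasis, Prod.fst_sum, Prod.smul_fst]
      refine LinearMap.pi_ext' fun i => LinearMap.ext_ring ?_
      simp [Pi.single_apply]
    · simp [hyperbolicBasis, Prod.snd_sum]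
  have hsum : (f, x) = (f, 0) + (0, x) := by simp
  rw [hsum, hx, hf]
  exact Submodule.add_mem _
    (Submodule.sum_mem _ fun i _ =>
      Submodule.smul_mem _ _ (Submodule.subset_span ⟨(false, i), rfl⟩))
    (Submodule.sum_mem _ fun i _ =>
      Submodule.smul_mem _ _ (Submodule.subset_span ⟨(true, i), rfl⟩))

open Matrix in
theorem toBilin'_sub_transpose_self {n : ℕ} (T : Matrix (Fin n) (Fin n) K) (x : Fin n → K) :
    toBilin' (T - Tᵀ) x x = 0 := by
  rw [toBilin'_apply', sub_mulVec, dotProduct_sub, mulVec_transpose, dotProduct_comm x (x ᵥ* T),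
    dotProduct_mulVec, sub_self]

open Matrix in
/-- The unipotent isometry `(f, x) ↦ (f + B x, x)` for the alternating form `B` whose matrix is
`T - Tᵀ`. -/
def unipotentHyperbolic {n : ℕ} (T : Matrix (Fin n) (Fin n) K) :
    orthogonalGroup (hyperbolicForm K n) :=
  ⟨{ toFun := fun v => (v.1 + toBilin' (T - Tᵀ) v.2, v.2)
     map_add' := fun v w => Prod.ext (by simp only [Prod.fst_add, Prod.snd_add, map_add]; abel) rfl
     map_smul' := fun a v => Prod.ext (by simp) rfl
     invFun := fun v => (v.1 - toBilin' (T - Tᵀ) v.2, v.2)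
     left_inv := fun v => by simp
     right_inv := fun v => by simp },
   fun v => by
    change (v.1 + toBilin' (T - Tᵀ) v.2) v.2 = v.1 v.2
    rw [LinearMap.add_apply, toBilin'_sub_transpose_self, add_zero]⟩

open Matrix in
theorem unipotentHyperbolic_strictLower_injective (n : ℕ) :
    Function.Injective fun c : LowerIndex n → K => unipotentHyperbolic (strictLower c) := by
  intro c d h
  refine eq_of_strictLower fun i j hij => ?_
  have h1 := congrArg (fun g => (g.1 ((0 : Module.Dual K (Fin n → K)), Pi.single i 1)).1
    (Pi.single j 1)) h
  have h2 : ∀ c : LowerIndex n → K, ((unipotentHyperbolic (strictLower c)).1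
      ((0 : Module.Dual K (Fin n → K)), Pi.single i 1)).1 (Pi.single j 1) = strictLower c i j := by
    intro c
    change ((0 : Module.Dual K (Fin n → K)) +
      toBilin' (strictLower c - (strictLower c)ᵀ) (Pi.single i 1)) (Pi.single j 1) = _
    rw [zero_add, toBilin'_single, Matrix.sub_apply, transpose_apply,
      strictLower_apply_of_le c hij.le, sub_zero]
  simpa only [h2] using h1

/-- The transfer to the derived group for a quadratic space containing a hyperbolic space on
whose complement, spanned by the vectors `u j`, the isometries of the hyperbolic space act
trivially. -/
theorem hasSpread_orthogonalGroup [Finite K] {V J : Type} [AddCommGroup V] [Module K V]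
    [Module.Finite K V] [Fintype J] {m : ℕ} (Q : QuadraticForm K V)
    (θ : orthogonalGroup (hyperbolicForm K (m + 1)) →* orthogonalGroup Q)
    (a : (Module.Dual K (Fin (m + 1) → K) × (Fin (m + 1) → K)) →ₗ[K] V)
    (ha : Function.Injective a) (hθa : ∀ g x, (θ g).1 (a x) = a (g.1 x)) (u : J → V)
    (hθu : ∀ g j, (θ g).1 (u j) = u j)
    (hspan : LinearMap.range a ⊔ Submodule.span K (Set.range u) = ⊤)
    (hJ : Fintype.card J ≤ 2) (hV : Module.finrank K V ≤ 2 * (m + 1) + 2) {t : ℕ}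
    (hm : 128 * (t + 2) ≤ m) : HasSpread (DerivedModCenter (orthogonalGroup Q)) t := by
  have hVfin : Finite V := Module.finite_of_finite K
  have : Finite (orthogonalGroup Q) :=
    Finite.of_injective (fun g v => g.1 v) fun x y h => Subtype.ext (LinearEquiv.ext (congrFun h))
  have hθ : Function.Injective θ := fun x y h => Subtype.ext (LinearEquiv.ext fun v =>
    ha (by rw [← hθa, ← hθa, h]))
  let w : Bool ⊕ J → Fin (m + 1) → V :=
    Sum.elim (fun b i => a (hyperbolicBasis K (m + 1) b i)) fun j _ => u j
  have hperm : PermutesSpanning (orthogonalRep Q) (θ.comp (permHyperbolic K (m + 1))) w :=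
    { injective := orthogonalRep_injective Q
      apply := by
        rintro σ (b | j) i
        · exact (hθa _ _).trans (congrArg a (permHyperbolic_apply σ b i))
        · exact hθu _ _
      span_eq_top := by
        rw [eq_top_iff, ← hspan, sup_le_iff]
        constructor
        · rw [LinearMap.range_eq_map, ← span_hyperbolicBasis, Submodule.map_span]
          refine Submodule.span_mono ?_
          rintro _ ⟨_, ⟨⟨b, i⟩, rfl⟩, rfl⟩
          exact ⟨(Sum.inl b, i), rfl⟩
        · refine Submodule.span_mono ?_
          rintro _ ⟨j, rfl⟩
          exact ⟨(Sum.inr j, 0), rfl⟩ }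
  refine hperm.hasSpread_modCenter ⟨Sum.inl true, fun i j h => ?_⟩ (by omega)
    (commutator (orthogonalGroup Q)).subtype (Subgroup.subtype_injective _)
    (by rw [Subgroup.range_subtype])
    (pow_card_le_of_injective _
      (hθ.comp (unipotentHyperbolic_strictLower_injective (K := K) (m + 1))) ?_)
  · by_contra hij
    have h1 := congrFun (congrArg Prod.snd (ha h)) i
    simp [hyperbolicBasis, hij] at h1
  · rw [Nat.le_div_iff_mul_le two_pos, Fintype.card_sum, Fintype.card_bool, Nat.add_sub_cancel]
    calc 4 * (2 + Fintype.card J) * Module.finrank K V * (t + 2) * 2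
        ≤ 4 * (2 + 2) * (2 * (m + 1) + 2) * (t + 2) * 2 := by gcongr
      _ ≤ 4 * (2 + 2) * (2 * (m + 1) + 2 * (m + 1)) * (t + 2) * 2 := by gcongr; omega
      _ = (m + 1) * (128 * (t + 2)) := by ring
      _ ≤ _ := Nat.mul_le_mul_left _ hm

/-- An isometry of the first factor of an orthogonal sum, extended by the identity. -/
def orthogonalGroupInl {V E : Type*} [AddCommGroup V] [Module K V] [AddCommGroup E] [Module K E]
    (Q : QuadraticForm K V) (Q' : QuadraticForm K E) :
    orthogonalGroup Q →* orthogonalGroup (QuadraticMap.prod Q Q') where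
  toFun g := ⟨LinearEquiv.prodCongr g.1 (LinearEquiv.refl K E), by
    rintro ⟨v, e⟩
    simp [QuadraticMap.prod_apply, g.2 v]⟩
  map_one' := rfl
  map_mul' _ _ := rfl

theorem hasSpread_orthogonalGroup_prod [Finite K] {E J : Type} [AddCommGroup E] [Module K E]
    [Module.Finite K E] [Fintype J] {m : ℕ} (Q : QuadraticForm K E) (u : J → E)
    (hu : Submodule.span K (Set.range u) = ⊤) (hJ : Fintype.card J ≤ 2)
    (hE : Module.finrank K E ≤ 2) {t : ℕ} (hm : 128 * (t + 2) ≤ m) :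
    HasSpread (DerivedModCenter
      (orthogonalGroup (QuadraticMap.prod (hyperbolicForm K (m + 1)) Q))) t := by
  refine hasSpread_orthogonalGroup _ (orthogonalGroupInl _ Q) (LinearMap.inl K _ E)
    LinearMap.inl_injective (fun g x => Prod.ext rfl rfl) (fun j => (0, u j))
    (fun g j => Prod.ext (map_zero g.1) rfl) ?_ hJ ?_ hm
  · have h : Set.range (fun j => ((0 : Module.Dual K (Fin (m + 1) → K) × (Fin (m + 1) → K)), u j)) =
        LinearMap.inr K (Module.Dual K (Fin (m + 1) → K) × (Fin (m + 1) → K)) E ''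
          Set.range u := by
      rw [← Set.range_comp]; rfl
    rw [h, ← Submodule.map_span, hu, ← LinearMap.range_eq_map, LinearMap.sup_range_inl_inr]
  · simp only [Module.finrank_prod, Subspace.dual_finrank_eq, Module.finrank_fintype_fun_eq_card,
      Fintype.card_fin]
    omega

theorem hasSpread_orthogonalGroup_hyperbolicForm [Finite K] {m t : ℕ} (hm : 128 * (t + 2) ≤ m) :
    HasSpread (DerivedModCenter (orthogonalGroup (hyperbolicForm K (m + 1)))) t := by
  refine hasSpread_orthogonalGroup (J := Empty) _ (MonoidHom.id _) LinearMap.id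
    Function.injective_id (fun _ _ => rfl) Empty.elim (fun _ j => j.elim) (by simp) (by simp) ?_ hm
  simp only [Module.finrank_prod, Subspace.dual_finrank_eq, Module.finrank_fintype_fun_eq_card,
    Fintype.card_fin]
  omega

theorem hasSpread_orthogonalGroup_oddForm [Finite K] {m t : ℕ} (hm : 128 * (t + 2) ≤ m) :
    HasSpread (DerivedModCenter (orthogonalGroup (oddForm K (m + 1)))) t :=
  hasSpread_orthogonalGroup_prod _ (fun _ : Unit => (1 : K))
    (by simp) (by simp) (by simp) hm

theorem hasSpread_orthogonalGroup_minusForm [Finite K] (c : K) {m t : ℕ}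
    (hm : 128 * (t + 2) ≤ m) :
    HasSpread (DerivedModCenter (orthogonalGroup (minusForm K (m + 1) c))) t := by
  refine hasSpread_orthogonalGroup_prod _ (fun b : Bool => if b then ((1 : K), (0 : K)) else (0, 1))
    ?_ (by simp) (by simp) hm
  rw [eq_top_iff]
  rintro ⟨x, y⟩ -
  have h : (x, y) = x • ((1 : K), (0 : K)) + y • ((0 : K), (1 : K)) := by simp
  rw [h]
  exact Submodule.add_mem _ (Submodule.smul_mem _ _ (Submodule.subset_span ⟨true, rfl⟩))
    (Submodule.smul_mem _ _ (Submodule.subset_span ⟨false, rfl⟩))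

end Orthogonal

/-! ### Groups of large rank -/

theorem HasRank.hasSpread {S : Type*} [Group S] [Finite S] {r t : ℕ} (h : HasRank S r)
    (hr : 128 * (t + 2) + 2 ≤ r) (halt : ∀ n, IsEmpty (S ≃* alternatingGroup (Fin n))) :
    HasSpread S t := by
  cases h with
  | alternating n e => exact ((halt r).false e).elim
  | linear K n hn e =>
    have := Finite.of_equiv _ e.toEquiv
    exact (hasSpread_projectiveSpecialLinearGroup (by omega)).of_mulEquiv e
  | unitary K hstar n hn e =>
    have := Finite.of_equiv _ e.toEquiv
    exact (hasSpread_specialUnitaryGroup (by omega)).of_mulEquiv e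
  | symplectic K n hn e =>
    have := Finite.of_equiv _ e.toEquiv
    obtain ⟨m, rfl⟩ : ∃ m, r = m + 1 := ⟨r - 1, by omega⟩
    exact (hasSpread_symplecticGroup (by omega)).of_mulEquiv e
  | orthogonalOdd K h2 n hn e =>
    have := Finite.of_equiv _ e.toEquiv
    obtain ⟨m, rfl⟩ : ∃ m, r = m + 1 := ⟨r - 1, by omega⟩
    exact (hasSpread_orthogonalGroup_oddForm (by omega)).of_mulEquiv e
  | orthogonalPlus K n hn e =>
    have := Finite.of_equiv _ e.toEquiv
    obtain ⟨m, rfl⟩ : ∃ m, r = m + 1 := ⟨r - 1, by omega⟩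
    exact (hasSpread_orthogonalGroup_hyperbolicForm (by omega)).of_mulEquiv e
  | orthogonalMinus K c hc n hn e =>
    have := Finite.of_equiv _ e.toEquiv
    obtain ⟨m, rfl⟩ : ∃ m, n = m + 1 := ⟨n - 1, by omega⟩
    exact (hasSpread_orthogonalGroup_minusForm c (by omega)).of_mulEquiv e
  | _ => omega

theorem logRatio_mulEquiv {G H : Type*} [Group G] [Group H] [Finite G] [Finite H] (e : G ≃* H)
    (g : G) : logRatio (e g) = logRatio g := by
  have h : (conjugatesOf (e g)).ncard = (conjugatesOf g).ncard :=
    le_antisymm (ncard_conjugatesOf_map_le e.toMonoidHom e.surjective g)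
      (ncard_conjugatesOf_le_map e.toMonoidHom e.injective g)
  rw [logRatio, logRatio, h, Nat.card_congr e.toEquiv]

theorem three_le_of_mulEquiv_alternatingGroup {S : Type*} [Group S] [Nontrivial S] {n : ℕ}
    (e : S ≃* alternatingGroup (Fin n)) : 3 ≤ n := by
  by_contra hn
  have h1 : Nat.card (alternatingGroup (Fin n)) ≤ 1 := by
    rcases Nat.lt_or_ge n 2 with h | h
    · have : Subsingleton (Fin n) := Fin.subsingleton_iff_le_one.2 (by omega)
      exact Finite.card_le_one_iff_subsingleton.2 inferInstance
    · have : Nontrivial (Fin n) := Fin.nontrivial_iff_two_le.2 h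
      have h2 := two_mul_nat_card_alternatingGroup (α := Fin n)
      rw [Nat.card_perm, Nat.card_fin, show n = 2 by omega, Nat.factorial_two] at h2
      rw [show n = 2 by omega]
      omega
  have : Nontrivial (alternatingGroup (Fin n)) := e.symm.toEquiv.nontrivial
  exact absurd Finite.one_lt_card (not_lt.2 h1)

theorem eq_of_mulEquiv_alternatingGroup {S : Type*} [Group S] [Nontrivial S] {n k : ℕ}
    (e : S ≃* alternatingGroup (Fin n)) (e' : S ≃* alternatingGroup (Fin k)) : n = k := by
  have hn := three_le_of_mulEquiv_alternatingGroup e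
  have hk := three_le_of_mulEquiv_alternatingGroup e'
  have : Nontrivial (Fin n) := Fin.nontrivial_iff_two_le.2 (by omega)
  have : Nontrivial (Fin k) := Fin.nontrivial_iff_two_le.2 (by omega)
  have h1 := two_mul_nat_card_alternatingGroup (α := Fin n)
  have h2 := two_mul_nat_card_alternatingGroup (α := Fin k)
  rw [Nat.card_perm, Nat.card_fin] at h1 h2
  rw [← Nat.card_congr e.toEquiv] at h1
  rw [← Nat.card_congr e'.toEquiv, h1] at h2
  exact (Nat.factorial_inj (by omega)).1 h2

/-- The elements which some isomorphism onto `A_n` maps to a cycle, whenever the group is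
isomorphic to an alternating group `A_n`; otherwise all elements. -/
def cycleLike (S : Type*) [Group S] : Set S :=
  {g | ∀ n, Nonempty (S ≃* alternatingGroup (Fin n)) →
    ∃ e : S ≃* alternatingGroup (Fin n), (e g : Equiv.Perm (Fin n)).IsCycle}

theorem symm_mem_cycleLike {S : Type*} [Group S] [Nontrivial S] {n : ℕ}
    (e : S ≃* alternatingGroup (Fin n)) {c : alternatingGroup (Fin n)}
    (hc : (c : Equiv.Perm (Fin n)).IsCycle) : e.symm c ∈ cycleLike S := by
  rintro k ⟨e'⟩
  obtain rfl := eq_of_mulEquiv_alternatingGroup e e'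
  exact ⟨e, by rwa [e.apply_symm_apply]⟩

theorem cycleLike_nonempty (S : Type*) [Group S] [Nontrivial S] : (cycleLike S).Nonempty := by
  by_cases h : ∃ n, Nonempty (S ≃* alternatingGroup (Fin n))
  · obtain ⟨n, ⟨e⟩⟩ := h
    have hn := three_le_of_mulEquiv_alternatingGroup e
    have : NeZero n := ⟨by omega⟩
    refine ⟨_, symm_mem_cycleLike e (c := ⟨Fin.cycleRange ⟨2, by omega⟩, ?_⟩) ?_⟩
    · simp [Equiv.Perm.mem_alternatingGroup, Fin.sign_cycleRange]
    · exact Fin.isCycle_cycleRange (by simp [Fin.ext_iff])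
  · exact ⟨1, fun n hn => (h ⟨n, hn⟩).elim⟩

theorem exists_mem_cycleLike_abs_logRatio_sub_le {S : Type*} [Group S] [Finite S]
    [IsSimpleGroup S] {t : ℕ} (ht : 0 < t) (hS : 128 * (t + 2) + 2 ≤ rank S) {β : ℝ}
    (hβ : β ∈ Set.Icc (0 : ℝ) 1) : ∃ g ∈ cycleLike S, |logRatio g - β| ≤ 1 / t := by
  by_cases h : ∃ n, Nonempty (S ≃* alternatingGroup (Fin n))
  · obtain ⟨n, ⟨e⟩⟩ := h
    have hn : rank S ≤ n := Nat.sInf_le (HasRank.alternating n e)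
    obtain ⟨m, rfl⟩ : ∃ m, n = m + 1 := ⟨n - 1, by omega⟩
    obtain ⟨c, hc, hcβ⟩ := exists_isCycle_abs_logRatio_sub_le (m := m) (by omega) ht
      (pow_le_card_alternatingGroup (by omega)) hβ
    exact ⟨e.symm c, symm_mem_cycleLike e hc, by rwa [logRatio_mulEquiv]⟩
  · have hr : HasRank S (rank S) :=
      Nat.sInf_mem (Nat.nonempty_of_pos_sInf (show 0 < rank S by omega))
    obtain ⟨g, hg⟩ := (hr.hasSpread hS fun n =>
      not_nonempty_iff.1 fun hn => h ⟨n, hn⟩).exists_abs_logRatio_sub_le ht hβ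
    exact ⟨g, fun n hn => (h ⟨n, hn⟩).elim, hg⟩

end FinSimple

end

theorem mainTheorem9 (S : ℕ → Type*) [∀ i, Group (S i)] [∀ i, Finite (S i)]
    [∀ i, IsSimpleGroup (S i)]
    (hrank : Tendsto (fun i => FinSimple.rank (S i)) atTop atTop)
    (β : ℝ) (hβ : β ∈ Set.Icc (0 : ℝ) 1) :
    ∃ g : ∀ i, S i,
      Tendsto (fun i => Real.log ((conjugatesOf (g i)).ncard : ℝ) /
        Real.log (Nat.card (S i) : ℝ)) atTop (𝓝 β) ∧
      ∀ i n, Nonempty (S i ≃* alternatingGroup (Fin n)) →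
        ∃ e : S i ≃* alternatingGroup (Fin n), ((e (g i) : Equiv.Perm (Fin n))).IsCycle := by
  -- In each group an admissible element with logarithmic class size closest to `β` is taken.
  choose g hg hmin using fun i => Set.exists_min_image (FinSimple.cycleLike (S i))
    (fun x => |FinSimple.logRatio x - β|) (Set.toFinite _) (FinSimple.cycleLike_nonempty (S i))
  refine ⟨g, ?_, hg⟩
  rw [Metric.tendsto_atTop]
  intro ε hε
  obtain ⟨t, ht⟩ := exists_nat_one_div_lt hε
  obtain ⟨N, hN⟩ := eventually_atTop.1
    (hrank.eventually_ge_atTop (128 * (t + 1 + 2) + 2))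
  refine ⟨N, fun i hi => ?_⟩
  obtain ⟨x, hx, hxβ⟩ :=
    FinSimple.exists_mem_cycleLike_abs_logRatio_sub_le t.succ_pos (hN i hi) hβ
  rw [Real.dist_eq]
  refine ((hmin i x hx).trans hxβ).trans_lt ?_
  simpa using ht
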